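/- Let $A$ be a commutative ring with unit and let $n,m\geqslant 1$ be integers. Let $\mathcal L^n(A)=A((t_1))\ldots((t_n))$ be the ring of iterated Laurent series, $\mathcal L^n(A)=\mathcal L^{n-1}(A)((t_n))$; its elements are written $f=\sum_{l\in\mathbb Z^n}a_lt^l$ with $t^l=t_1^{l_1}\ldots t_n^{l_n}$ and $a_l\in A$. Topology. Put $\Lambda_1=\mathbb Z$, $\Lambda_n=\mathrm{Map}(\mathbb Z,\Lambda_{n-1})\times\mathbb Z$, $\mathbb Z^1_\lambda=\{l\in\mathbb Z\mid l\geqslant\lambda\}$, and $\mathbb Z^n_{\lambda}=\bigcup_{l_n\geqslant\lambda_n}\mathbb Z^{n-1}_{\lambda'(l_n)}\times\{l_n\}$ for $\lambda=(\lambda',\lambda_n)\in\Lambda_n$, $n\geqslant 2$. The ring $\mathcal L^n(A)$ carries the translation-invariant topology in which the sets $U_\lambda=\{\sum a_lt^l\mid a_l=0\text{ for all } l\in-\mathbb Z^n_\lambda\}$, $\lambda\in\Lambda_n$, form a base of open neighbourhoods of zero. All continuity and convergence below refer to these topologies. Valuation. Order $\mathbb Z^m$ lexicographically, comparing the last coordinates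 first. For $f=\sum a_lt^l\in\mathcal L^m(A)^*$ let $\nu(f)$ be the locally constant function $\mathrm{Spec}(A)\to\mathbb Z^m$ characterized as follows: there is a finite decomposition $A\simeq\prod_i A_i$ such that on each $\mathrm{Spec}(A_i)$ the function $\nu(f)$ has a constant value $d_i$, the image of $a_l$ in $A_i$ is nilpotent for every $l<d_i$, and the image of $a_{d_i}$ in $A_i$ is invertible. (It is known that $\nu(f)$ exists and is unique.) Let $\mathbb H_{m,n}(A)$ be the set of all $(\varphi_1,\ldots,\varphi_n)\in(\mathcal L^m(A)^*)^{\times n}$ such that at every point of $\mathrm{Spec}(A)$ the integral $(m\times n)$-matrix with columns $\nu(\varphi_1),\ldots,\nu(\varphi_n)$ is in column echelon form with positive leading entries, that is, there are $1\leqslant p_1<\ldots<p_n\leqslant m$ such that the $(p_j,j)$-entry is positive and all $(i,j)$-entries with $i>p_j$ vanish, for every $j$. Theorem. The map $$\phi\longmapsto(\phi(t_1),\ldots,\phi(t_n))$$ is a bijection from the set of all continuous homomorphisms of $A$-algebras $\phi\colon\mathcal L^n(A)\to\mathcal L^m(A)$ onto $\mathbb H_{m,n}(A)$. The inverse bijection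 sends $\varphi=(\varphi_1,\ldots,\varphi_n)$ to the homomorphism $$f=\sum_{l\in\mathbb Z^n}a_lt^l\longmapsto f(\varphi_1,\ldots,\varphi_n)=\sum_{l\in\mathbb Z^n}a_l\,\varphi_1^{l_1}\ldots\varphi_n^{l_n},$$ where the series converges (in any order of summation) in $\mathcal L^m(A)$. -/

import Mathlib

namespace IterLaurent

universe u

/-- The `A`-algebras `L⁰(A) = A` and `Lⁿ⁺¹(A) = Lⁿ(A)((t_{n+1}))`, bundled. Scalars act on a
Laurent series coefficientwise (`HahnSeries.instAlgebra`). -/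
noncomputable def bundled (A : Type u) [CommRing A] : ℕ → CommAlgCat.{u} A
  | 0 => CommAlgCat.of A A
  | n + 1 => @CommAlgCat.of A _ (LaurentSeries (bundled A n)) _ HahnSeries.instAlgebra

/-- The ring `Lⁿ(A) = A((t_1))…((t_n))` of iterated Laurent series. The variable `t_n`, which has
the index `Fin.last` in `Fin n`, is the outermost one. -/
def L (n : ℕ) (A : Type u) [CommRing A] : Type u := bundled A n

noncomputable instance (n : ℕ) (A : Type u) [CommRing A] : CommRing (L n A) :=
  inferInstanceAs (CommRing (bundled A n))

noncomputable instance (n : ℕ) (A : Type u) [CommRing A] : Algebra A (L n A) :=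
  inferInstanceAs (Algebra A (bundled A n))

/-- The coefficient of `f` at `t^l = t_1^{l_1} ⋯ t_n^{l_n}`. -/
def coeff {A : Type u} [CommRing A] : (n : ℕ) → L n A → (Fin n → ℤ) → A
  | 0, f, _ => f
  | n + 1, f, l => coeff n (HahnSeries.coeff (Γ := ℤ) (R := L n A) f (l (Fin.last n))) (Fin.init l)

/-- The monomial `t^l = t_1^{l_1} ⋯ t_n^{l_n}`. -/
noncomputable def monomial (A : Type u) [CommRing A] : (n : ℕ) → (Fin n → ℤ) → L n A
  | 0, _ => (1 : A)
  | n + 1, l => HahnSeries.single (Γ := ℤ) (R := L n A) (l (Fin.last n)) (monomial A n (Fin.init l))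

/-- The variable `t_i`. -/
noncomputable def t (A : Type u) [CommRing A] {n : ℕ} (i : Fin n) : L n A :=
  monomial A n (Pi.single i 1)

/-- The index sets `Λ_n`: up to the trivial factor `ℤ → Λ_0`, one has `Λ_1 = ℤ`, and
`Λ_{n+1} = Map(ℤ, Λ_n) × ℤ`. -/
def Lam : ℕ → Type
  | 0 => Unit
  | n + 1 => (ℤ → Lam n) × ℤ

/-- The set `ℤⁿ_lam`: those `l` with `l_n ≥ lam_n` and `(l_1, …, l_{n-1}) ∈ ℤⁿ⁻¹_{lam'(l_n)}`, where
`lam = (lam', lam_n)`. -/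
def cone : (n : ℕ) → Lam n → Set (Fin n → ℤ)
  | 0, _ => Set.univ
  | n + 1, lam => {l | lam.2 ≤ l (Fin.last n) ∧ Fin.init l ∈ cone n (lam.1 (l (Fin.last n)))}

/-- The set `U_lam` of all `f` whose support is disjoint from `-ℤⁿ_lam`. -/
def U {A : Type u} [CommRing A] {n : ℕ} (lam : Lam n) : Set (L n A) :=
  {f | ∀ l : Fin n → ℤ, -l ∈ cone n lam → coeff n f l = 0}

theorem Lam.nonempty (n : ℕ) : Nonempty (Lam n) := by
  induction n with
  | zero => exact ⟨()⟩
  | succ n ih => exact ⟨(fun _ => ih.some, 0)⟩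

theorem exists_cone_union (n : ℕ) (a b : Lam n) : ∃ c, cone n a ∪ cone n b ⊆ cone n c := by
  induction n with
  | zero => exact ⟨(), fun _ _ => trivial⟩
  | succ n ih =>
    choose F hF using ih
    refine ⟨(fun k => F (a.1 k) (b.1 k), min a.2 b.2), ?_⟩
    rintro l (h | h)
    · exact ⟨(min_le_left _ _).trans h.1, hF _ _ (Or.inl h.2)⟩
    · exact ⟨(min_le_right _ _).trans h.1, hF _ _ (Or.inr h.2)⟩

/-- The natural topology of `Lⁿ(A)`: the cosets `f + U_lam` form a base of neighbourhoods
of `f`. -/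
instance (n : ℕ) (A : Type u) [CommRing A] : TopologicalSpace (L n A) where
  IsOpen s := ∀ f ∈ s, ∃ lam : Lam n, ∀ g : L n A, g - f ∈ U lam → g ∈ s
  isOpen_univ _ _ := ⟨(Lam.nonempty n).some, fun _ _ => trivial⟩
  isOpen_inter s s' hs hs' f hf := by
    obtain ⟨a, ha⟩ := hs f hf.1
    obtain ⟨b, hb⟩ := hs' f hf.2
    obtain ⟨c, hc⟩ := exists_cone_union n a b
    exact ⟨c, fun g hg => ⟨ha g fun l hl => hg l (hc (Or.inl hl)),
      hb g fun l hl => hg l (hc (Or.inr hl))⟩⟩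
  isOpen_sUnion S hS f := by
    rintro ⟨s, hs, hf⟩
    obtain ⟨a, ha⟩ := hS s hs f hf
    exact ⟨a, fun g hg => ⟨s, hs, ha g hg⟩⟩

/-- The strict lexicographical order on `ℤⁿ` in which the last coordinate is compared first. -/
def LexLT {n : ℕ} (l l' : Fin n → ℤ) : Prop :=
  ∃ i, l i < l' i ∧ ∀ j, i < j → l j = l' j

/-- The locally constant function `v` on `Spec A` is the valuation of `f`: there is a finite
decomposition `A = ∏ A_i`, `A_i = e_i A`, such that `v` has a constant value `d_i` on each
`Spec A_i`, the coefficients in `A_i` of `f` at all `l < d_i` are nilpotent and the coefficient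
in `A_i` of `f` at `d_i` is invertible. -/
def IsValuation {A : Type u} [CommRing A] {n : ℕ} (f : L n A)
    (v : LocallyConstant (PrimeSpectrum A) (Fin n → ℤ)) : Prop :=
  ∃ (N : ℕ) (e : Fin N → A) (d : Fin N → Fin n → ℤ), CompleteOrthogonalIdempotents e ∧
    ∀ i, (∀ x : PrimeSpectrum A, e i ∉ x.asIdeal → v x = d i) ∧
      (∀ l, LexLT l (d i) → IsNilpotent (e i * coeff n f l)) ∧
      ∃ b, b * (e i * coeff n f (d i)) = e i

open Classical in
/-- The valuation `ν(f)` of an invertible iterated Laurent series `f`. It is a known fact that it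
exists, and it is unique; the value `0` in the other case is never taken. -/
noncomputable def nu {A : Type u} [CommRing A] {n : ℕ} (f : (L n A)ˣ) :
    LocallyConstant (PrimeSpectrum A) (Fin n → ℤ) :=
  if h : ∃ v, IsValuation (f : L n A) v then h.choose else 0

/-- The matrix `M` is in column echelon form with positive leading entries: the last non-zero
entry of the column `j` is positive and stands in the row `p j`, where `p` is strictly
increasing. -/
def IsPosEchelon {m n : ℕ} (M : Matrix (Fin m) (Fin n) ℤ) : Prop :=
  ∃ p : Fin n → Fin m, StrictMono p ∧ ∀ j, 0 < M (p j) j ∧ ∀ i, p j < i → M i j = 0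

/-- The matrix with the columns `ν(φ_1), …, ν(φ_n)`, whose entries are locally constant integral
functions on `Spec A`. -/
noncomputable def valMatrix {A : Type u} [CommRing A] {m n : ℕ} (φ : Fin n → (L m A)ˣ) :
    Matrix (Fin m) (Fin n) (LocallyConstant (PrimeSpectrum A) ℤ) :=
  Matrix.of fun i j => (nu (φ j)).map fun l => l i

/-- The set of all collections of `n` invertible series in `Lᵐ(A)` whose valuation matrix is, at
every point of `Spec A`, in column echelon form with positive leading entries. -/
def H (m n : ℕ) (A : Type u) [CommRing A] : Set (Fin n → (L m A)ˣ) :=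
  {φ | ∀ x : PrimeSpectrum A, IsPosEchelon ((valMatrix φ).map fun v => v x)}

end IterLaurent

namespace IterLaurent

universe u

open Pointwise

/-! Call a set of exponents admissible if it lies in some cone `ℤⁿ_lam`. Supports of series are
exactly the admissible sets, the sets `V S` with `S` admissible describe the topology, and
admissibility is self-dual: `S` is admissible iff `S ∩ -T` is finite for all admissible `T`
(`Adm.finite_inter_neg`, `Adm.of_finite_inter`). This duality makes a family `a_l w_l` summable
whenever the `w_l` tend to zero (`exists_hasSum`), so everything reduces to monomials.

For `φ` in `H`, the products `∏ φ_i ^ l_i` must tend to zero. Modulo each prime `x` of `A`, a unit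
has a lowest monomial with exponent `leadAt u x`; this is additive in `u` and locally constant in
`x`, and it is `ν(u)`. On a component of `A` where the exponents are constant, `∏ φ_i ^ l_i` is
`t^(M l)`, with `M` the valuation matrix, times a product of powers of units of valuation zero. The
powers of such units have supports in one admissible set (`PowerBounded.of_leadAt`), and preimages
of admissible sets under an echelon matrix are admissible (`Adm.preimage_mulVec`). Hence evaluation
is defined and continuous, and it is multiplicative because it is so on monomials.

Conversely, let `ϕ` be continuous. If `δ` is lexicographically positive then `t^(kδ)` tends to zero,
which forces `ϕ(t^δ)` to have positive valuation at every prime (`leadMap_pos`). A homomorphism of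
lexicographically ordered groups `ℤⁿ → ℤᵐ` that preserves positivity has an echelon matrix
(`IsPosEchelon.of_lexLT`), so the images of the variables lie in `H`. A continuous linear map is
determined by its values on monomials, so the two constructions are inverse to each other. -/

/-- The vector `(l_1, …, l_n, k)`. -/
def push {n : ℕ} (l : Fin n → ℤ) (k : ℤ) : Fin (n + 1) → ℤ := Fin.snoc (α := fun _ => ℤ) l k

@[simp] theorem push_last {n : ℕ} (l : Fin n → ℤ) (k : ℤ) : push l k (Fin.last n) = k :=
  Fin.snoc_last (α := fun _ => ℤ) _ _

@[simp] theorem init_push {n : ℕ} (l : Fin n → ℤ) (k : ℤ) : Fin.init (push l k) = l :=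
  Fin.init_snoc (α := fun _ => ℤ) _ _

@[simp] theorem push_init {n : ℕ} (l : Fin (n + 1) → ℤ) :
    push (Fin.init l) (l (Fin.last n)) = l :=
  Fin.snoc_init_self l

theorem eq_push_iff {n : ℕ} {l : Fin (n + 1) → ℤ} {l' : Fin n → ℤ} {k : ℤ} :
    l = push l' k ↔ Fin.init l = l' ∧ l (Fin.last n) = k := by
  constructor
  · rintro rfl; simp
  · rintro ⟨rfl, rfl⟩; simp

theorem init_add {n : ℕ} (a b : Fin (n + 1) → ℤ) : Fin.init (a + b) = Fin.init a + Fin.init b := rfl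

theorem init_neg {n : ℕ} (a : Fin (n + 1) → ℤ) : Fin.init (-a) = -Fin.init a := rfl

/-! ### Admissible sets of exponents and their duality -/

/-- The admissible subsets of `ℤⁿ`, that is, those that are contained in one of the sets `ℤⁿ_lam`:
the last coordinate is bounded below and all slices are admissible. -/
def Adm : (n : ℕ) → Set (Fin n → ℤ) → Prop
  | 0, _ => True
  | n + 1, S => (∃ N, ∀ l ∈ S, N ≤ l (Fin.last n)) ∧ ∀ k, Adm n {l | push l k ∈ S}

theorem Adm.mono {n : ℕ} {S T : Set (Fin n → ℤ)} (hT : Adm n T) (h : S ⊆ T) : Adm n S := by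
  induction n with
  | zero => trivial
  | succ n ih =>
    obtain ⟨⟨N, hN⟩, hs⟩ := hT
    exact ⟨⟨N, fun l hl => hN l (h hl)⟩, fun k => ih (hs k) fun l hl => h hl⟩

theorem Adm.union {n : ℕ} {S T : Set (Fin n → ℤ)} (hS : Adm n S) (hT : Adm n T) :
    Adm n (S ∪ T) := by
  induction n with
  | zero => trivial
  | succ n ih =>
    obtain ⟨⟨N, hN⟩, hs⟩ := hS
    obtain ⟨⟨N', hN'⟩, hs'⟩ := hT
    refine ⟨⟨min N N', ?_⟩, fun k => (ih (hs k) (hs' k)).mono fun l hl => hl⟩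
    rintro l (h | h)
    · exact (min_le_left _ _).trans (hN l h)
    · exact (min_le_right _ _).trans (hN' l h)

theorem Adm.empty (n : ℕ) : Adm n ∅ := by
  induction n with
  | zero => trivial
  | succ n ih => exact ⟨⟨0, by simp⟩, fun k => ih.mono fun l hl => hl⟩

theorem Adm.singleton {n : ℕ} (a : Fin n → ℤ) : Adm n {a} := by
  induction n with
  | zero => trivial
  | succ n ih =>
    refine ⟨⟨a (Fin.last n), by simp⟩, fun k => (ih (Fin.init a)).mono ?_⟩
    rintro l hl
    obtain rfl : push l k = a := hl
    simp

theorem Adm.biUnion {n : ℕ} {ι : Type*} {s : Set ι} (hs : s.Finite) {S : ι → Set (Fin n → ℤ)}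
    (h : ∀ i ∈ s, Adm n (S i)) : Adm n (⋃ i ∈ s, S i) := by
  induction s, hs using Set.Finite.induction_on with
  | empty => simpa using Adm.empty n
  | @insert a s _ _ ih =>
    rw [Set.biUnion_insert]
    exact (h a (by simp)).union (ih fun i hi => h i (by simp [hi]))

theorem Adm.of_finite {n : ℕ} {S : Set (Fin n → ℤ)} (h : S.Finite) : Adm n S := by
  rw [← Set.biUnion_of_singleton S]
  exact Adm.biUnion h fun i _ => Adm.singleton i

theorem Adm.add {n : ℕ} {S T : Set (Fin n → ℤ)} (hS : Adm n S) (hT : Adm n T) :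
    Adm n (S + T) := by
  induction n with
  | zero => trivial
  | succ n ih =>
    obtain ⟨⟨N, hN⟩, hs⟩ := hS
    obtain ⟨⟨N', hN'⟩, hs'⟩ := hT
    refine ⟨⟨N + N', ?_⟩, fun k => ?_⟩
    · rintro _ ⟨a, ha, b, hb, rfl⟩
      exact add_le_add (hN a ha) (hN' b hb)
    · refine Adm.mono (Adm.biUnion (Set.finite_Icc N (k - N'))
        fun i _ => ih (hs i) (hs' (k - i))) ?_
      rintro l ⟨a, ha, b, hb, hab⟩
      have hk : a (Fin.last n) + b (Fin.last n) = k := by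
        have := congrFun hab (Fin.last n); simpa using this
      have hl : Fin.init a + Fin.init b = l := by
        have := congrArg Fin.init hab; simpa [init_add] using this
      simp only [Set.mem_iUnion]
      refine ⟨a (Fin.last n), ⟨hN a ha, by linarith [hN' b hb]⟩, ?_⟩
      refine ⟨Fin.init a, by simpa using ha, Fin.init b, ?_, hl⟩
      rw [← hk]
      simpa using hb

/-- The last coordinate is bounded on both sides, so only finitely many slices occur, and each is
finite by induction. -/
theorem Adm.finite_inter_neg {n : ℕ} {S T : Set (Fin n → ℤ)} (hS : Adm n S) (hT : Adm n T) :
    (S ∩ -T).Finite := by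
  induction n with
  | zero => exact Set.toFinite _
  | succ n ih =>
    obtain ⟨⟨N, hN⟩, hs⟩ := hS
    obtain ⟨⟨N', hN'⟩, hs'⟩ := hT
    refine Set.Finite.subset (Set.Finite.biUnion (Set.finite_Icc N (-N'))
      fun k _ => (ih (hs k) (hs' (-k))).image fun l => push l k) ?_
    rintro l ⟨h, h'⟩
    simp only [Set.mem_iUnion]
    refine ⟨l (Fin.last n), ⟨hN l h, ?_⟩, Fin.init l, ⟨by simpa using h, ?_⟩, push_init l⟩
    · have := hN' _ h'
      simp only [Pi.neg_apply] at this
      linarith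
    · have : push (-Fin.init l) (-l (Fin.last n)) = -l := (eq_push_iff.2 ⟨init_neg l, rfl⟩).symm
      simpa [this] using h'

/-- If the last coordinate were unbounded below on `S`, one could pick infinitely many vectors of
`S` with distinct negative last coordinates. The negatives of these form an admissible set, having
at most one point in each slice, which contradicts finiteness. -/
theorem Adm.of_finite_inter {n : ℕ} {S : Set (Fin n → ℤ)}
    (h : ∀ T, Adm n T → (S ∩ -T).Finite) : Adm n S := by
  induction n with
  | zero => trivial
  | succ n ih =>
    constructor
    · by_contra! hN
      choose g hg hg' using hN
      -- choose one vector of `S` for every negative value of the last coordinate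
      let P : ℤ → Prop := fun k => k < 0 ∧ ∃ l ∈ S, l (Fin.last n) = k
      have hex : ∀ k : {k // P k}, ∃ l ∈ S, l (Fin.last n) = k.1 := fun k => k.2.2
      choose c hc hc' using hex
      have hfin := h (Set.range fun k => -c k) ?_
      · obtain ⟨B, hB⟩ := (hfin.image fun l => l (Fin.last n)).bddBelow
        have hP : P (g (min B 0) (Fin.last n)) :=
          ⟨(hg' _).trans_le (min_le_right _ _), _, hg _, rfl⟩
        have := hB ⟨c ⟨_, hP⟩, ⟨hc _, ⟨⟨_, hP⟩, rfl⟩⟩, hc' _⟩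
        have := hg' (min B 0)
        have := min_le_left B 0
        linarith
      · refine ⟨⟨0, ?_⟩, fun k => ?_⟩
        · rintro _ ⟨k, rfl⟩
          have := k.2.1
          simp only [Pi.neg_apply, hc']
          linarith
        · refine Adm.of_finite (Set.Subsingleton.finite ?_)
          rintro a ⟨i, hi⟩ b ⟨j, hj⟩
          have hi' := congrFun hi (Fin.last n)
          have hj' := congrFun hj (Fin.last n)
          simp only [Pi.neg_apply, hc', push_last] at hi' hj'
          obtain rfl : i = j := Subtype.ext (by linarith)
          simpa using congrArg Fin.init (hi.symm.trans hj)
    · refine fun k => ih fun T hT => ?_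
      -- A test set for the slice at `k` is placed at level `-k`, so that its negative meets `S`
      -- only within that slice.
      have := h ((fun l => push l (-k)) '' T) ⟨⟨-k, ?_⟩, fun j => hT.mono ?_⟩
      · refine Set.Finite.subset (this.image Fin.init) ?_
        rintro l ⟨hl, hl'⟩
        refine ⟨push l k, ⟨hl, -l, hl', ?_⟩, init_push l k⟩
        exact (eq_push_iff.2 (by simp [init_neg])).symm
      · rintro _ ⟨l, _, rfl⟩
        simp
      · rintro l ⟨a, ha, hal⟩
        have := congrArg Fin.init hal
        simp only [init_push] at this
        rwa [← this]

theorem adm_cone (n : ℕ) (lam : Lam n) : Adm n (cone n lam) := by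
  induction n with
  | zero => trivial
  | succ n ih =>
    refine ⟨⟨lam.2, fun l hl => hl.1⟩, fun k => (ih (lam.1 k)).mono ?_⟩
    rintro l ⟨_, hl⟩
    simpa using hl

/-- With `adm_cone`, this lets arbitrary admissible sets replace the cones in the definition of the
topology. -/
theorem Adm.exists_subset_cone {n : ℕ} {S : Set (Fin n → ℤ)} (hS : Adm n S) :
    ∃ lam, S ⊆ cone n lam := by
  induction n with
  | zero => exact ⟨(), fun _ _ => trivial⟩
  | succ n ih =>
    obtain ⟨⟨N, hN⟩, hs⟩ := hS
    choose F hF using fun k => ih (hs k)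
    exact ⟨(F, N), fun l hl => ⟨hN l hl, hF _ (by simpa using hl)⟩⟩

/-! ### The lexicographical order -/

theorem lexLT_succ {n : ℕ} {a b : Fin (n + 1) → ℤ} : LexLT a b ↔ a (Fin.last n) < b (Fin.last n) ∨
    a (Fin.last n) = b (Fin.last n) ∧ LexLT (Fin.init a) (Fin.init b) := by
  constructor
  · rintro ⟨i, hi, h⟩
    induction i using Fin.lastCases with
    | last => exact Or.inl hi
    | cast i =>
      exact Or.inr ⟨h _ (Fin.castSucc_lt_last i), i, hi, fun j hj => h _ (by simpa using hj)⟩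
  · rintro (h | ⟨h, i, hi, h'⟩)
    · exact ⟨Fin.last n, h, fun j hj => absurd hj (Fin.le_last j).not_gt⟩
    · refine ⟨i.castSucc, hi, fun j hj => ?_⟩
      induction j using Fin.lastCases with
      | last => exact h
      | cast j => exact h' j (by simpa using hj)

theorem LexLT.irrefl {n : ℕ} (a : Fin n → ℤ) : ¬LexLT a a := fun ⟨_, h, _⟩ => lt_irrefl _ h

theorem LexLT.trichotomy {n : ℕ} (a b : Fin n → ℤ) : LexLT a b ∨ a = b ∨ LexLT b a := by
  induction n with
  | zero => exact Or.inr (Or.inl (Subsingleton.elim _ _))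
  | succ n ih =>
    rw [lexLT_succ, lexLT_succ]
    rcases lt_trichotomy (a (Fin.last n)) (b (Fin.last n)) with h | h | h
    · exact Or.inl (Or.inl h)
    · rcases ih (Fin.init a) (Fin.init b) with h' | h' | h'
      · exact Or.inl (Or.inr ⟨h, h'⟩)
      · refine Or.inr (Or.inl ?_)
        rw [← push_init a, ← push_init b, h, h']
      · exact Or.inr (Or.inr (Or.inr ⟨h.symm, h'⟩))
    · exact Or.inr (Or.inr (Or.inl h))

theorem LexLT.trans {n : ℕ} {a b c : Fin n → ℤ} (h : LexLT a b) (h' : LexLT b c) : LexLT a c := by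
  obtain ⟨i, hi, hi'⟩ := h
  obtain ⟨j, hj, hj'⟩ := h'
  rcases lt_trichotomy i j with hij | rfl | hij
  · exact ⟨j, (hi' j hij).trans_lt hj, fun k hk => (hi' k (hij.trans hk)).trans (hj' k hk)⟩
  · exact ⟨i, hi.trans hj, fun k hk => (hi' k hk).trans (hj' k hk)⟩
  · exact ⟨i, hi.trans_eq (hj' i hij), fun k hk => (hi' k hk).trans (hj' k (hij.trans hk))⟩

theorem lexLT_iff_sub {n : ℕ} {a b : Fin n → ℤ} : LexLT a b ↔ LexLT 0 (b - a) := by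
  simp only [LexLT, Pi.sub_apply, Pi.zero_apply, sub_pos]
  refine exists_congr fun i => and_congr Iff.rfl (forall₂_congr fun j _ => ?_)
  rw [eq_comm, ← sub_eq_zero, eq_comm]

/-- If the last coordinate of `d` is positive, every level contains at most one multiple; if it is
zero, all multiples lie in level zero and induction applies. -/
theorem adm_multiples {n : ℕ} {d : Fin n → ℤ} (hd : ¬LexLT d 0) :
    Adm n (Set.range fun k : ℕ => (k : ℤ) • d) := by
  induction n with
  | zero => trivial
  | succ n ih =>
    rw [lexLT_succ, not_or] at hd
    have h0 : 0 ≤ d (Fin.last n) := not_lt.1 hd.1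
    refine ⟨⟨0, ?_⟩, fun j => ?_⟩
    · rintro _ ⟨k, rfl⟩
      simp only [Pi.smul_apply, smul_eq_mul]
      positivity
    · rcases h0.eq_or_lt with h | h
      · refine (ih (d := Fin.init d) fun h' => hd.2 ⟨h.symm, h'⟩).mono ?_
        rintro l ⟨k, hk⟩
        exact ⟨k, (congrArg Fin.init hk).trans (init_push l j)⟩
      · refine Adm.of_finite (Set.Subsingleton.finite ?_)
        rintro a ⟨i, hi⟩ b ⟨k, hk⟩
        have hi' := congrFun hi (Fin.last n)
        have hk' := congrFun hk (Fin.last n)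
        simp only [Pi.smul_apply, smul_eq_mul, push_last] at hi' hk'
        obtain rfl : i = k := by exact_mod_cast mul_right_cancel₀ h.ne' (hi'.trans hk'.symm)
        simpa using congrArg Fin.init (hi.symm.trans hk)

/-! ### Echelon matrices and admissible sets -/

/-- Passing repeatedly to the slice at level zero makes `q` the last coordinate. -/
theorem Adm.exists_le_of_eq_zero {m : ℕ} {S : Set (Fin m → ℤ)} (hS : Adm m S) (q : Fin m) :
    ∃ N, ∀ l ∈ S, (∀ i, q < i → l i = 0) → N ≤ l q := by
  induction m with
  | zero => exact q.elim0
  | succ m ih =>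
    induction q using Fin.lastCases with
    | last =>
      obtain ⟨N, hN⟩ := hS.1
      exact ⟨N, fun l hl _ => hN l hl⟩
    | cast q =>
      obtain ⟨N, hN⟩ := ih (hS.2 0) q
      refine ⟨N, fun l hl h => hN (Fin.init l) ?_ fun i hi => h _ (by simpa using hi)⟩
      have : push (Fin.init l) 0 = l := by rw [← h _ (Fin.castSucc_lt_last q), push_init]
      simpa [this] using hl

/-- In the rows from the leading entry of the last column downwards, all other columns vanish. So `M
l` has zeros below that row and a positive multiple of `l_n` in it, which bounds `l_n` from below.
Once `l_n` is fixed, the last column only translates `S`, and the remaining columns are again in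
echelon form. -/
theorem Adm.preimage_mulVec {m n : ℕ} {S : Set (Fin m → ℤ)} (hS : Adm m S)
    {M : Matrix (Fin m) (Fin n) ℤ} (hM : IsPosEchelon M) : Adm n {l | M.mulVec l ∈ S} := by
  induction n generalizing S with
  | zero => trivial
  | succ n ih =>
    obtain ⟨p, hp, hpM⟩ := hM
    have hdec : ∀ l, M.mulVec l = (M.submatrix id Fin.castSucc).mulVec (Fin.init l) +
        l (Fin.last n) • fun i => M i (Fin.last n) := by
      intro l
      ext i
      simp [Matrix.mulVec, dotProduct, Fin.sum_univ_castSucc, Fin.init, mul_comm]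
    constructor
    · obtain ⟨N, hN⟩ := hS.exists_le_of_eq_zero (p (Fin.last n))
      -- The leading entry is at least 1, so `l_n < -|N|` would make its product with `l_n` smaller
      -- than `N`.
      refine ⟨-|N|, fun l hl => ?_⟩
      have h1 : ∀ i, p (Fin.last n) ≤ i → M.mulVec l i = l (Fin.last n) * M i (Fin.last n) := by
        intro i hi
        rw [hdec]
        have : (M.submatrix id Fin.castSucc).mulVec (Fin.init l) i = 0 := by
          simp only [Matrix.mulVec, dotProduct]
          refine Finset.sum_eq_zero fun j _ => ?_
          simp [(hpM j.castSucc).2 i ((hp (Fin.castSucc_lt_last j)).trans_le hi)]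
        simp [this]
      have h2 := hN _ hl fun i hi => by rw [h1 i hi.le, (hpM _).2 i hi, mul_zero]
      rw [h1 _ le_rfl] at h2
      have h3 := (hpM (Fin.last n)).1
      by_contra! h4
      have : N ≤ |N| ∧ -|N| ≤ N := ⟨le_abs_self N, neg_abs_le N⟩
      nlinarith [abs_nonneg N]
    · intro k
      have hM' : IsPosEchelon (M.submatrix id Fin.castSucc) :=
        ⟨fun j => p j.castSucc, fun i j hij => hp (by simpa using hij), fun j => hpM j.castSucc⟩
      refine (ih (hS.add (Adm.singleton (-(k • fun i => M i (Fin.last n))))) hM').mono ?_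
      intro l hl
      refine ⟨_, hl, _, rfl, ?_⟩
      simp only [hdec, init_push, push_last]
      abel

theorem IsPosEchelon.of_lexLT {m n : ℕ} {d : Fin n → Fin m → ℤ} (h0 : ∀ j, LexLT 0 (d j))
    (h : ∀ i j, i < j → ∀ C : ℕ, LexLT 0 (d j - (C : ℤ) • d i)) :
    IsPosEchelon (Matrix.of fun i j => d j i) := by
  choose p hp hp' using h0
  refine ⟨p, fun i j hij => ?_, fun j => ⟨hp j, fun i hi => (hp' j i hi).symm⟩⟩
  by_contra! hle
  -- If the leading row of `d j` were not below that of `d i`, subtracting this many copies of `d i`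
  -- would make the coordinate `p i` negative and leave zeros after it.
  obtain ⟨q, hq, hq'⟩ := h i j hij ((d j (p i)).natAbs + 1)
  have hi := hp i
  have habs := le_abs_self (d j (p i))
  have hlt : d j (p i) - (|d j (p i)| + 1) * d i (p i) < 0 := by
    simp only [Pi.zero_apply] at hi
    nlinarith [abs_nonneg (d j (p i))]
  simp only [Pi.zero_apply, Pi.sub_apply, Pi.smul_apply, smul_eq_mul, Nat.cast_add, Nat.cast_one,
    Int.natCast_natAbs] at hq hq'
  rcases lt_trichotomy q (p i) with hqi | rfl | hqi
  · exact absurd (hq' _ hqi) hlt.ne'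
  · exact hq.not_gt hlt
  · have h1 := hp' i q hqi
    have h2 := hp' j q (hle.trans_lt hqi)
    simp only [Pi.zero_apply] at h1 h2
    rw [← h1, ← h2] at hq
    simp at hq


/-! ### Slices, coefficients, supports and monomials -/

section Structure

variable {A : Type u} [CommRing A]

/-- An element of `Lⁿ⁺¹(A)` as a Laurent series over `Lⁿ(A)`. -/
noncomputable def toSeries (n : ℕ) : L (n + 1) A ≃+* LaurentSeries (L n A) where
  toFun f := f
  invFun f := f
  left_inv _ := rfl
  right_inv _ := rfl
  map_mul' _ _ := rfl
  map_add' _ _ := rfl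

/-- The coefficient in `Lⁿ(A)` of `f ∈ Lⁿ⁺¹(A)` at the `k`-th power of the last variable. -/
noncomputable def slice {n : ℕ} (f : L (n + 1) A) (k : ℤ) : L n A :=
  HahnSeries.coeff (toSeries n f) k

theorem coeff_succ {n : ℕ} (f : L (n + 1) A) (l : Fin (n + 1) → ℤ) :
    coeff (n + 1) f l = coeff n (slice f (l (Fin.last n))) (Fin.init l) := rfl

theorem coeff_push {n : ℕ} (f : L (n + 1) A) (l : Fin n → ℤ) (k : ℤ) :
    coeff (n + 1) f (push l k) = coeff n (slice f k) l := by
  rw [coeff_succ, push_last, init_push]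

theorem slice_add {n : ℕ} (f g : L (n + 1) A) (k : ℤ) :
    slice (f + g) k = slice f k + slice g k := rfl

theorem slice_smul {n : ℕ} (a : A) (f : L (n + 1) A) (k : ℤ) :
    slice (a • f) k = a • slice f k := rfl

theorem slice_zero {n : ℕ} (k : ℤ) : slice (0 : L (n + 1) A) k = 0 := rfl

theorem slice_ext {n : ℕ} {f g : L (n + 1) A} (h : ∀ k, slice f k = slice g k) : f = g :=
  (toSeries n).injective (HahnSeries.ext (funext h))

theorem exists_slice_eq_zero {n : ℕ} (f : L (n + 1) A) : ∃ N, ∀ k < N, slice f k = 0 :=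
  ⟨(toSeries n f).order, fun _ hk => HahnSeries.coeff_eq_zero_of_lt_order hk⟩

theorem exists_slice_eq {n : ℕ} (c : ℤ → L n A) (N : ℤ) (h : ∀ k < N, c k = 0) :
    ∃ f : L (n + 1) A, ∀ k, slice f k = c k := by
  have hb : BddBelow (Function.support c) := by
    refine ⟨N, fun k hk => ?_⟩
    by_contra! hlt
    exact hk (h k hlt)
  refine ⟨(toSeries n).symm (HahnSeries.ofSuppBddBelow c hb), fun k => ?_⟩
  simp [slice]

theorem coeff_add {n : ℕ} (f g : L n A) (l : Fin n → ℤ) :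
    coeff n (f + g) l = coeff n f l + coeff n g l := by
  induction n with
  | zero => rfl
  | succ n ih => rw [coeff_succ, slice_add, ih, ← coeff_succ, ← coeff_succ]

theorem coeff_smul {n : ℕ} (a : A) (f : L n A) (l : Fin n → ℤ) :
    coeff n (a • f) l = a * coeff n f l := by
  induction n with
  | zero => rfl
  | succ n ih => rw [coeff_succ, slice_smul, ih, ← coeff_succ]

/-- The coefficient at `t^l` as a linear form. -/
noncomputable def coeffHom (n : ℕ) (l : Fin n → ℤ) : L n A →ₗ[A] A where
  toFun f := coeff n f l
  map_add' f g := coeff_add f g l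
  map_smul' a f := coeff_smul a f l

theorem coeffHom_apply {n : ℕ} (f : L n A) (l : Fin n → ℤ) : coeffHom n l f = coeff n f l := rfl

theorem coeff_sub {n : ℕ} (f g : L n A) (l : Fin n → ℤ) :
    coeff n (f - g) l = coeff n f l - coeff n g l := by
  simp only [← coeffHom_apply, map_sub]

theorem coeff_neg {n : ℕ} (f : L n A) (l : Fin n → ℤ) : coeff n (-f) l = -coeff n f l := by
  simp only [← coeffHom_apply, map_neg]

theorem coeff_zero {n : ℕ} (l : Fin n → ℤ) : coeff n (0 : L n A) l = 0 := by
  simp only [← coeffHom_apply, map_zero]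

theorem coeff_sum {n : ℕ} {ι : Type*} (s : Finset ι) (f : ι → L n A) (l : Fin n → ℤ) :
    coeff n (∑ i ∈ s, f i) l = ∑ i ∈ s, coeff n (f i) l := by
  simp only [← coeffHom_apply, map_sum]

theorem coeff_ext {n : ℕ} {f g : L n A} (h : ∀ l, coeff n f l = coeff n g l) : f = g := by
  induction n with
  | zero => exact h 0
  | succ n ih => exact slice_ext fun k => ih fun l => by rw [← coeff_push, ← coeff_push, h]

/-- The support of an iterated Laurent series. -/
def supp {n : ℕ} (f : L n A) : Set (Fin n → ℤ) := {l | coeff n f l ≠ 0}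

theorem mem_supp {n : ℕ} {f : L n A} {l : Fin n → ℤ} : l ∈ supp f ↔ coeff n f l ≠ 0 := Iff.rfl

theorem push_mem_supp {n : ℕ} {f : L (n + 1) A} {l : Fin n → ℤ} {k : ℤ} :
    push l k ∈ supp f ↔ l ∈ supp (slice f k) := by
  rw [mem_supp, mem_supp, coeff_push]

theorem adm_supp {n : ℕ} (f : L n A) : Adm n (supp f) := by
  induction n with
  | zero => trivial
  | succ n ih =>
    obtain ⟨N, hN⟩ := exists_slice_eq_zero f
    refine ⟨⟨N, fun l hl => ?_⟩, fun k => (ih (slice f k)).mono fun l hl => push_mem_supp.1 hl⟩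
    by_contra! h
    exact hl (by rw [coeff_succ, hN _ h, coeff_zero])

/-- The converse of `adm_supp`: series are built from their coefficients slice by slice. -/
theorem exists_coeff_eq {n : ℕ} (a : (Fin n → ℤ) → A) (ha : Adm n {l | a l ≠ 0}) :
    ∃ f : L n A, ∀ l, coeff n f l = a l := by
  induction n with
  | zero => exact ⟨a 0, fun l => congrArg a (Subsingleton.elim _ _)⟩
  | succ n ih =>
    obtain ⟨⟨N, hN⟩, hs⟩ := ha
    choose c hc using fun k => ih (fun l => a (push l k)) (hs k)
    obtain ⟨f, hf⟩ := exists_slice_eq c N fun k hk => coeff_ext fun l => by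
      rw [hc, coeff_zero]
      by_contra h
      have := hN _ h
      rw [push_last] at this
      exact hk.not_ge this
    exact ⟨f, fun l => by rw [coeff_succ, hf, hc, push_init]⟩

theorem supp_smul_subset {n : ℕ} (a : A) (f : L n A) : supp (a • f) ⊆ supp f := by
  intro l hl h
  exact hl (by rw [coeff_smul, h, mul_zero])

theorem supp_sum_subset {n : ℕ} {ι : Type*} (s : Finset ι) (f : ι → L n A)
    {T : Set (Fin n → ℤ)} (h : ∀ i ∈ s, supp (f i) ⊆ T) : supp (∑ i ∈ s, f i) ⊆ T := by
  intro l hl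
  rw [mem_supp, coeff_sum] at hl
  obtain ⟨i, hi, h'⟩ := Finset.exists_ne_zero_of_sum_ne_zero hl
  exact h i hi h'

theorem slice_mul {n : ℕ} (f g : L (n + 1) A) (k : ℤ) :
    slice (f * g) k = ∑ ij ∈ Finset.antidiagonal (toSeries n f).isPWO_support
      (toSeries n g).isPWO_support k, slice f ij.1 * slice g ij.2 := by
  rw [slice, map_mul, HahnSeries.coeff_mul]
  rfl

theorem supp_mul_subset {n : ℕ} (f g : L n A) : supp (f * g) ⊆ supp f + supp g := by
  induction n with
  | zero =>
    intro l hl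
    have h : (f : A) * (g : A) ≠ 0 := hl
    exact ⟨l, left_ne_zero_of_mul h, 0, right_ne_zero_of_mul h, Subsingleton.elim _ _⟩
  | succ n ih =>
    intro l hl
    rw [← push_init l, push_mem_supp, slice_mul] at hl
    rw [mem_supp, coeff_sum] at hl
    obtain ⟨ij, hij, h⟩ := Finset.exists_ne_zero_of_sum_ne_zero hl
    obtain ⟨a, ha, b, hb, hab⟩ := ih _ _ h
    refine ⟨push a ij.1, push_mem_supp.2 ha, push b ij.2, push_mem_supp.2 hb, ?_⟩
    have h' := (Finset.mem_antidiagonal.1 hij).2.2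
    rw [← push_init l, ← h', ← hab]
    refine eq_push_iff.2 ⟨?_, ?_⟩
    · simp [init_add]
    · simp

theorem slice_monomial {n : ℕ} (l : Fin (n + 1) → ℤ) (k : ℤ) :
    slice (monomial A (n + 1) l) k =
      if k = l (Fin.last n) then monomial A n (Fin.init l) else 0 := by
  split_ifs with h
  · subst h
    exact HahnSeries.coeff_single_same _ _
  · exact HahnSeries.coeff_single_of_ne h

theorem coeff_monomial {n : ℕ} (l r : Fin n → ℤ) :
    coeff n (monomial A n l) r = if r = l then 1 else 0 := by
  induction n with
  | zero => rw [if_pos (Subsingleton.elim _ _)]; rfl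
  | succ n ih =>
    rw [coeff_succ, slice_monomial]
    by_cases h : r (Fin.last n) = l (Fin.last n)
    · rw [if_pos h, ih]
      refine if_congr ⟨fun h' => ?_, congrArg Fin.init⟩ rfl rfl
      rw [← push_init r, ← push_init l, h, h']
    · rw [if_neg h, if_neg fun h' => h (congrFun h' _), coeff_zero]

theorem monomial_add {n : ℕ} (l l' : Fin n → ℤ) :
    monomial A n (l + l') = monomial A n l * monomial A n l' := by
  induction n with
  | zero => exact (one_mul (1 : A)).symm
  | succ n ih =>
    refine (congrArg _ (ih _ _)).trans ?_
    exact (HahnSeries.single_mul_single (Γ := ℤ) (R := L n A)).symm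

theorem monomial_zero (n : ℕ) : monomial A n 0 = 1 := by
  induction n with
  | zero => rfl
  | succ n ih => exact (congrArg _ ih).trans rfl

theorem supp_monomial_subset {n : ℕ} (l : Fin n → ℤ) : supp (monomial A n l) ⊆ {l} := by
  intro r hr
  by_contra h
  exact hr ((coeff_monomial l r).trans (if_neg h))

theorem supp_one_subset (n : ℕ) : supp (1 : L n A) ⊆ {0} := by
  rw [← monomial_zero]
  exact supp_monomial_subset 0

/-- The monomial `t^l` as a unit. -/
noncomputable def monomialUnit (A : Type u) [CommRing A] {n : ℕ} (l : Fin n → ℤ) : (L n A)ˣ where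
  val := monomial A n l
  inv := monomial A n (-l)
  val_inv := by rw [← monomial_add, add_neg_cancel, monomial_zero]
  inv_val := by rw [← monomial_add, neg_add_cancel, monomial_zero]

theorem coe_monomialUnit {n : ℕ} (l : Fin n → ℤ) :
    (monomialUnit A l : L n A) = monomial A n l := rfl

theorem monomialUnit_add {n : ℕ} (l l' : Fin n → ℤ) :
    monomialUnit A (l + l') = monomialUnit A l * monomialUnit A l' :=
  Units.ext (monomial_add l l')

theorem monomialUnit_zero (n : ℕ) : monomialUnit A (0 : Fin n → ℤ) = 1 :=
  Units.ext (monomial_zero n)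

/-- `l ↦ t^l` as a homomorphism. -/
noncomputable def monomialHom (A : Type u) [CommRing A] (n : ℕ) :
    Multiplicative (Fin n → ℤ) →* (L n A)ˣ where
  toFun l := monomialUnit A l.toAdd
  map_one' := monomialUnit_zero n
  map_mul' _ _ := monomialUnit_add _ _

theorem monomialUnit_zsmul {n : ℕ} (k : ℤ) (l : Fin n → ℤ) :
    monomialUnit A (k • l) = monomialUnit A l ^ k :=
  map_zpow (monomialHom A n) (Multiplicative.ofAdd l) k

theorem monomialUnit_sum {n : ℕ} {ι : Type*} (s : Finset ι) (l : ι → Fin n → ℤ) :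
    monomialUnit A (∑ i ∈ s, l i) = ∏ i ∈ s, monomialUnit A (l i) :=
  map_prod (monomialHom A n) (fun i => Multiplicative.ofAdd (l i)) s

theorem monomialUnit_eq_prod {n : ℕ} (l : Fin n → ℤ) :
    monomialUnit A l = ∏ i, monomialUnit A (Pi.single i 1) ^ l i := by
  have h : l = ∑ i, l i • (Pi.single i 1 : Fin n → ℤ) := by
    ext j
    simp [Finset.sum_apply, Pi.single_apply]
  conv_lhs => rw [h]
  rw [monomialUnit_sum]
  simp only [monomialUnit_zsmul]

end Structure

/-! ### Functoriality in the ring of coefficients -/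

section Map

variable {A B : Type u} [CommRing A] [CommRing B]

/-- The homomorphism of rings of Laurent series induced by a homomorphism of rings. -/
noncomputable def mapSeries {R S : Type*} [CommRing R] [CommRing S] (φ : R →+* S) :
    LaurentSeries R →+* LaurentSeries S where
  toFun f := f.map φ
  map_one' := HahnSeries.map_one φ.toMonoidWithZeroHom
  map_mul' _ _ := HahnSeries.map_mul (φ : R →ₙ+* S)
  map_zero' := HahnSeries.map_zero (φ : ZeroHom R S)
  map_add' _ _ := HahnSeries.map_add (φ : R →+ S)

theorem coeff_mapSeries {R S : Type*} [CommRing R] [CommRing S] (φ : R →+* S)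
    (f : LaurentSeries R) (k : ℤ) : (mapSeries φ f).coeff k = φ (f.coeff k) := rfl

/-- The homomorphism of rings of iterated Laurent series induced by a homomorphism of rings. -/
noncomputable def mapL (φ : A →+* B) : (n : ℕ) → (L n A →+* L n B)
  | 0 => φ
  | n + 1 => (toSeries n).symm.toRingHom.comp
      ((mapSeries (mapL φ n)).comp (toSeries n).toRingHom)

theorem slice_mapL (φ : A →+* B) {n : ℕ} (f : L (n + 1) A) (k : ℤ) :
    slice (mapL φ (n + 1) f) k = mapL φ n (slice f k) := rfl

theorem coeff_mapL (φ : A →+* B) {n : ℕ} (f : L n A) (l : Fin n → ℤ) :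
    coeff n (mapL φ n f) l = φ (coeff n f l) := by
  induction n with
  | zero => rfl
  | succ n ih => rw [coeff_succ, slice_mapL, ih, coeff_succ]

end Map

/-! ### The topology and summable families -/

section Topology

variable {A : Type u} [CommRing A]

/-- The subgroup of all series whose support is disjoint from `-S`. -/
def V {n : ℕ} (S : Set (Fin n → ℤ)) : AddSubgroup (L n A) where
  carrier := {f | ∀ l ∈ S, coeff n f (-l) = 0}
  zero_mem' l _ := coeff_zero _
  add_mem' hf hg l hl := by rw [coeff_add, hf l hl, hg l hl, add_zero]
  neg_mem' hf l hl := by rw [coeff_neg, hf l hl, neg_zero]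

theorem U_eq {n : ℕ} (lam : Lam n) : U lam = ((V (cone n lam) : AddSubgroup (L n A)) : Set (L n A)) := by
  ext f
  refine ⟨fun h l hl => h _ (by rwa [neg_neg]), fun h l hl => ?_⟩
  have := h _ hl
  rwa [neg_neg] at this

theorem V_anti {n : ℕ} {S T : Set (Fin n → ℤ)} (h : S ⊆ T) : (V T : AddSubgroup (L n A)) ≤ V S :=
  fun _ hf l hl => hf l (h hl)

theorem smul_mem_V {n : ℕ} {S : Set (Fin n → ℤ)} {f : L n A} (hf : f ∈ V S) (a : A) :
    a • f ∈ V S := fun l hl => by rw [coeff_smul, hf l hl, mul_zero]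

theorem isOpen_iff {n : ℕ} {s : Set (L n A)} :
    IsOpen s ↔ ∀ f ∈ s, ∃ S, Adm n S ∧ ∀ g, g - f ∈ V S → g ∈ s := by
  change (∀ f ∈ s, ∃ lam : Lam n, ∀ g : L n A, g - f ∈ U lam → g ∈ s) ↔ _
  refine forall₂_congr fun f _ => ⟨?_, ?_⟩
  · rintro ⟨lam, h⟩
    exact ⟨_, adm_cone n lam, fun g hg => h g (by rw [U_eq]; exact hg)⟩
  · rintro ⟨S, hS, h⟩
    obtain ⟨lam, hlam⟩ := hS.exists_subset_cone
    refine ⟨lam, fun g hg => h g (V_anti hlam ?_)⟩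
    rwa [U_eq] at hg

theorem isOpen_coset {n : ℕ} {S : Set (Fin n → ℤ)} (hS : Adm n S) (f : L n A) :
    IsOpen {g | g - f ∈ V S} := by
  refine isOpen_iff.2 fun g hg => ⟨S, hS, fun h hh => ?_⟩
  have := (V S).add_mem hh hg
  rwa [sub_add_sub_cancel] at this

theorem mem_nhds_iff {n : ℕ} {f : L n A} {s : Set (L n A)} :
    s ∈ nhds f ↔ ∃ S, Adm n S ∧ ∀ g, g - f ∈ V S → g ∈ s := by
  rw [_root_.mem_nhds_iff]
  constructor
  · rintro ⟨t, hts, ht, hf⟩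
    obtain ⟨S, hS, h⟩ := isOpen_iff.1 ht f hf
    exact ⟨S, hS, fun g hg => hts (h g hg)⟩
  · rintro ⟨S, hS, h⟩
    refine ⟨{g | g - f ∈ V S}, h, isOpen_coset hS f, ?_⟩
    rw [Set.mem_ofPred_eq, sub_self]
    exact (V S).zero_mem

theorem tendsto_iff {n : ℕ} {ι : Type*} {F : Filter ι} {u : ι → L n A} {f : L n A} :
    Filter.Tendsto u F (nhds f) ↔ ∀ S, Adm n S → ∀ᶠ i in F, u i - f ∈ V S := by
  constructor
  · intro h S hS
    exact h (mem_nhds_iff.2 ⟨S, hS, fun g hg => hg⟩)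
  · intro h s hs
    obtain ⟨S, hS, hs'⟩ := mem_nhds_iff.1 hs
    exact (h S hS).mono fun i hi => hs' _ hi

instance (n : ℕ) : T2Space (L n A) := by
  refine ⟨fun f g hfg => ?_⟩
  obtain ⟨l, hl⟩ : ∃ l, coeff n f l ≠ coeff n g l := by
    by_contra! h
    exact hfg (coeff_ext h)
  have h0 : ∀ f : L n A, f - f ∈ V {-l} := fun f => by
    rw [sub_self]
    exact (V _).zero_mem
  refine ⟨_, _, isOpen_coset (Adm.singleton (-l)) f, isOpen_coset (Adm.singleton (-l)) g, h0 f,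
    h0 g, Set.disjoint_left.2 fun h hf hg => hl ?_⟩
  have h1 := (V _).sub_mem hg hf (-l) rfl
  rwa [sub_sub_sub_cancel_left, neg_neg, coeff_sub, sub_eq_zero] at h1

instance (n : ℕ) : ContinuousAdd (L n A) := by
  refine ⟨continuous_iff_continuousAt.2 fun ⟨f, g⟩ => tendsto_iff.2 fun S hS => ?_⟩
  have hmem : ∀ f : L n A, {g | g - f ∈ V S} ∈ nhds f := fun f =>
    mem_nhds_iff.2 ⟨S, hS, fun h hh => hh⟩
  filter_upwards [prod_mem_nhds (hmem f) (hmem g)] with p hp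
  have := (V S).add_mem hp.1 hp.2
  rwa [sub_add_sub_comm] at this

theorem continuous_of_linear {m n : ℕ} (Φ : L n A →+ L m A)
    (h : ∀ S, Adm m S → ∃ T, Adm n T ∧ ∀ f ∈ V T, Φ f ∈ V S) : Continuous Φ := by
  refine continuous_iff_continuousAt.2 fun f => tendsto_iff.2 fun S hS => ?_
  obtain ⟨T, hT, hTS⟩ := h S hS
  refine mem_nhds_iff.2 ⟨T, hT, fun g hg => ?_⟩
  have := hTS _ hg
  rwa [map_sub] at this

theorem hasSum_iff {n : ℕ} {ι : Type*} {u : ι → L n A} {f : L n A} :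
    HasSum u f ↔ ∀ S, Adm n S → ∃ s : Finset ι, ∀ s', s ⊆ s' → ∑ i ∈ s', u i - f ∈ V S := by
  rw [HasSum, SummationFilter.unconditional_filter, tendsto_iff]
  simp only [Filter.eventually_atTop]

/-- An open subgroup is closed: the limit differs from some partial sum by an element of `V S`. -/
theorem mem_V_of_hasSum {n : ℕ} {ι : Type*} {u : ι → L n A} {f : L n A} (h : HasSum u f)
    {S : Set (Fin n → ℤ)} (hS : Adm n S) (hu : ∀ i, u i ∈ V S) : f ∈ V S := by
  obtain ⟨s, hs⟩ := hasSum_iff.1 h S hS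
  have := (V S).sub_mem ((V S).sum_mem fun i (_ : i ∈ s) => hu i) (hs s subset_rfl)
  rwa [sub_sub_cancel] at this

/-- A coefficient of `f * g` at an exponent in `-S` only involves coefficients of `f` at exponents
in `-(supp g + S)`, and this sum of sets is admissible. -/
theorem continuous_mul_const {n : ℕ} (g : L n A) : Continuous fun f => f * g := by
  refine continuous_of_linear (AddMonoidHom.mulRight g) fun S hS =>
    ⟨_, (adm_supp g).add hS, fun f hf l hl => ?_⟩
  by_contra h
  obtain ⟨a, ha, b, hb, hab⟩ := supp_mul_subset f g h
  refine ha ?_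
  have := hf (b + l) ⟨b, hb, l, hl, rfl⟩
  have hab : a + b = -l := hab
  rwa [show -(b + l) = a by rw [neg_add_rev, ← hab, add_neg_cancel_right]] at this

/-- Families of series whose members tend to zero sum up. -/
theorem exists_hasSum {n m : ℕ} (w : (Fin n → ℤ) → L m A)
    (hw : ∀ S, Adm m S → ∃ T, Adm n T ∧ ∀ l, -l ∉ T → w l ∈ V S) (f : L n A) :
    ∃ g, HasSum (fun l => coeff n f l • w l) g := by
  -- A term outside `V S` has its index in `supp f ∩ -T`, which is finite by duality.
  have hfin : ∀ S, Adm m S → {l | coeff n f l • w l ∉ V S}.Finite := by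
    intro S hS
    obtain ⟨T, hT, h⟩ := hw S hS
    refine ((adm_supp f).finite_inter_neg hT).subset fun l hl => ⟨fun h0 => hl ?_, ?_⟩
    · rw [h0, zero_smul]
      exact (V S).zero_mem
    · by_contra h1
      exact hl (smul_mem_V (h l h1) _)
  have hcoeff : ∀ S, Adm m S → ∀ r ∈ S, ∀ s : Finset (Fin n → ℤ),
      {l | coeff n f l • w l ∉ V S} ⊆ s →
      ∑ᶠ l, coeff m (coeff n f l • w l) (-r) = ∑ l ∈ s, coeff m (coeff n f l • w l) (-r) := by
    intro S hS r hr s hs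
    refine finsum_eq_sum_of_support_subset _ fun l hl => hs fun hl' => hl (hl' r hr)
  -- The limit is defined coefficientwise. Its support meets each `-S` only in the supports of the
  -- finitely many terms outside `V S`, hence is admissible by duality.
  obtain ⟨g, hg⟩ := exists_coeff_eq (fun r => ∑ᶠ l, coeff m (coeff n f l • w l) r)
    (Adm.of_finite_inter fun S hS => by
      refine ((Set.Finite.biUnion (hfin S hS) fun l _ =>
        (adm_supp (coeff n f l • w l)).finite_inter_neg hS)).subset ?_
      rintro r ⟨hr, hr'⟩
      have h1 := hcoeff S hS (-r) hr' (hfin S hS).toFinset (by simp)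
      rw [neg_neg] at h1
      rw [Set.mem_ofPred_eq, h1] at hr
      obtain ⟨l, hl, hl'⟩ := Finset.exists_ne_zero_of_sum_ne_zero hr
      simp only [Set.mem_iUnion]
      exact ⟨l, by simpa using hl, hl', hr'⟩)
  refine ⟨g, hasSum_iff.2 fun S hS => ⟨(hfin S hS).toFinset, fun s hs r hr => ?_⟩⟩
  rw [coeff_sub, coeff_sum, hg, hcoeff S hS r hr s (by
    intro l hl; exact hs (by simpa using hl)), sub_self]

theorem hasSum_monomial {n : ℕ} (f : L n A) :
    HasSum (fun l => coeff n f l • monomial A n l) f := by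
  obtain ⟨g, hg⟩ := exists_hasSum (monomial A n) (fun S hS => ⟨S, hS, fun l hl r hr => by
    rw [coeff_monomial, if_neg]
    rintro rfl
    exact hl (by rwa [neg_neg])⟩) f
  convert hg
  refine coeff_ext fun r => ?_
  -- Testing convergence against `{-r}` isolates the coefficient at `r`; inserting `r` makes sure
  -- that its own term is counted.
  obtain ⟨s, hs⟩ := hasSum_iff.1 hg {-r} (Adm.singleton _)
  have h := hs (insert r s) (Finset.subset_insert _ _) (-r) rfl
  rw [neg_neg, coeff_sub, coeff_sum, sub_eq_zero] at h
  simpa [coeff_smul, coeff_monomial] using h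

end Topology


/-! ### Lowest monomials over a domain -/

section Lead

variable {A : Type u} [CommRing A]

instance [IsDomain A] (n : ℕ) : IsDomain (L n A) := by
  induction n with
  | zero => exact (inferInstance : IsDomain A)
  | succ n ih => exact (toSeries n).toMulEquiv.isDomain _

/-- The monomial `t^d` is the lowest one that occurs in `f`. -/
def IsLead {n : ℕ} (f : L n A) (d : Fin n → ℤ) : Prop :=
  coeff n f d ≠ 0 ∧ ∀ l, LexLT l d → coeff n f l = 0

theorem IsLead.unique {n : ℕ} {f : L n A} {d d' : Fin n → ℤ} (h : IsLead f d) (h' : IsLead f d') :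
    d = d' := by
  rcases LexLT.trichotomy d d' with h1 | h1 | h1
  · exact absurd (h'.2 _ h1) h.1
  · exact h1
  · exact absurd (h.2 _ h1) h'.1

theorem isLead_succ {n : ℕ} {f : L (n + 1) A} {d : Fin (n + 1) → ℤ} : IsLead f d ↔
    (∀ k < d (Fin.last n), slice f k = 0) ∧ IsLead (slice f (d (Fin.last n))) (Fin.init d) := by
  constructor
  · rintro ⟨h, h'⟩
    refine ⟨fun k hk => coeff_ext fun l => ?_, h, fun l hl => ?_⟩
    · rw [coeff_zero, ← coeff_push]
      exact h' _ (lexLT_succ.2 (Or.inl (by simpa using hk)))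
    · rw [← coeff_push]
      exact h' _ (lexLT_succ.2 (Or.inr (by simpa using hl)))
  · rintro ⟨h, h', h''⟩
    refine ⟨h', fun l hl => ?_⟩
    rw [coeff_succ]
    rcases lexLT_succ.1 hl with hl | ⟨hl, hl'⟩
    · rw [h _ hl, coeff_zero]
    · rw [hl]
      exact h'' _ hl'

theorem exists_isLead {n : ℕ} {f : L n A} (hf : f ≠ 0) : ∃ d, IsLead f d := by
  induction n with
  | zero => exact ⟨0, hf, fun l ⟨i, _⟩ => i.elim0⟩
  | succ n ih =>
    have h0 : slice f (toSeries n f).order ≠ 0 := by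
      rw [slice, Ne, HahnSeries.coeff_order_eq_zero, map_eq_zero_iff _ (toSeries n).injective]
      exact hf
    obtain ⟨d, hd⟩ := ih h0
    refine ⟨push d (toSeries n f).order, isLead_succ.2 ?_⟩
    rw [push_last, init_push]
    exact ⟨fun k hk => HahnSeries.coeff_eq_zero_of_lt_order hk, hd⟩

theorem order_eq_of_slice {n : ℕ} {f : L (n + 1) A} {k : ℤ} (hk : slice f k ≠ 0)
    (h : ∀ j < k, slice f j = 0) : (toSeries n f).order = k := by
  have h0 : toSeries n f ≠ 0 := by
    intro h0
    exact hk (by rw [slice, h0, HahnSeries.coeff_zero])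
  refine le_antisymm (HahnSeries.order_le_of_coeff_ne_zero hk) ?_
  rw [HahnSeries.le_order_iff_forall h0]
  exact h

theorem IsLead.ne_zero {n : ℕ} {f : L n A} {d : Fin n → ℤ} (h : IsLead f d) : f ≠ 0 := by
  rintro rfl
  exact h.1 (coeff_zero d)

/-- Over a domain, orders of Laurent series add and leading coefficients multiply; this is applied
one variable at a time. -/
theorem IsLead.mul [IsDomain A] {n : ℕ} {f g : L n A} {d d' : Fin n → ℤ} (hf : IsLead f d)
    (hg : IsLead g d') : IsLead (f * g) (d + d') := by
  induction n with
  | zero => exact ⟨mul_ne_zero (M₀ := A) hf.1 hg.1, fun l ⟨i, _⟩ => i.elim0⟩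
  | succ n ih =>
    have hf0 := (toSeries n).map_ne_zero_iff.2 hf.ne_zero
    have hg0 := (toSeries n).map_ne_zero_iff.2 hg.ne_zero
    rw [isLead_succ] at hf hg ⊢
    have hof := order_eq_of_slice hf.2.ne_zero hf.1
    have hog := order_eq_of_slice hg.2.ne_zero hg.1
    constructor
    · intro k hk
      refine HahnSeries.coeff_eq_zero_of_lt_order ?_
      rwa [map_mul, HahnSeries.order_mul hf0 hg0, hof, hog]
    · have h : slice (f * g) ((d + d') (Fin.last n)) =
          slice f (d (Fin.last n)) * slice g (d' (Fin.last n)) := by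
        have := HahnSeries.coeff_mul_order_add_order (toSeries n f) (toSeries n g)
        rw [HahnSeries.leadingCoeff_eq, HahnSeries.leadingCoeff_eq, hof, hog, ← map_mul] at this
        exact this
      rw [h, init_add]
      exact ih hf.2 hg.2

theorem isLead_one [Nontrivial A] (n : ℕ) : IsLead (1 : L n A) 0 := by
  rw [← monomial_zero]
  refine ⟨by simp [coeff_monomial], fun l hl => ?_⟩
  rw [coeff_monomial, if_neg]
  rintro rfl
  exact LexLT.irrefl _ hl

end Lead

/-! ### The valuation as a function on the spectrum -/

section Spec

variable {A : Type u} [CommRing A]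

/-- The reduction of iterated Laurent series modulo a prime ideal. -/
noncomputable abbrev red (x : PrimeSpectrum A) (n : ℕ) : L n A →+* L n (A ⧸ x.asIdeal) :=
  mapL (Ideal.Quotient.mk x.asIdeal) n

theorem coeff_red_eq_zero {x : PrimeSpectrum A} {n : ℕ} {f : L n A} {l : Fin n → ℤ} :
    coeff n (red x n f) l = 0 ↔ coeff n f l ∈ x.asIdeal := by
  rw [coeff_mapL, Ideal.Quotient.eq_zero_iff_mem]

theorem exists_isLead_red (u : (L n A)ˣ) (x : PrimeSpectrum A) :
    ∃ d, IsLead (red x n u) d :=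
  exists_isLead (u.isUnit.map (red x n)).ne_zero

/-- The exponent of the lowest monomial in the reduction of a unit modulo a prime ideal. -/
noncomputable def leadAt {n : ℕ} (u : (L n A)ˣ) (x : PrimeSpectrum A) : Fin n → ℤ :=
  (exists_isLead_red u x).choose

theorem isLead_leadAt {n : ℕ} (u : (L n A)ˣ) (x : PrimeSpectrum A) :
    IsLead (red x n u) (leadAt u x) :=
  (exists_isLead_red u x).choose_spec

theorem leadAt_eq_iff {n : ℕ} {u : (L n A)ˣ} {x : PrimeSpectrum A} {d : Fin n → ℤ} :
    leadAt u x = d ↔ IsLead (red x n u) d :=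
  ⟨fun h => h ▸ isLead_leadAt u x, (isLead_leadAt u x).unique⟩

theorem leadAt_mul {n : ℕ} (u v : (L n A)ˣ) (x : PrimeSpectrum A) :
    leadAt (u * v) x = leadAt u x + leadAt v x := by
  rw [leadAt_eq_iff, Units.val_mul, map_mul]
  exact (isLead_leadAt u x).mul (isLead_leadAt v x)

theorem leadAt_one {n : ℕ} (x : PrimeSpectrum A) : leadAt (1 : (L n A)ˣ) x = 0 := by
  rw [leadAt_eq_iff, Units.val_one, map_one]
  exact isLead_one n

/-- The exponent of the lowest monomial as a homomorphism. -/
noncomputable def leadHom (n : ℕ) (x : PrimeSpectrum A) :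
    (L n A)ˣ →* Multiplicative (Fin n → ℤ) where
  toFun u := Multiplicative.ofAdd (leadAt u x)
  map_one' := congrArg _ (leadAt_one x)
  map_mul' u v := congrArg _ (leadAt_mul u v x)

theorem leadAt_inv {n : ℕ} (u : (L n A)ˣ) (x : PrimeSpectrum A) : leadAt u⁻¹ x = -leadAt u x :=
  map_inv (leadHom n x) u

/-- The lowest exponent at `x` is at most `d` iff some coefficient at an exponent at most `d` lies
outside `x`; this is a union of basic open sets. -/
theorem isOpen_not_lexLT_leadAt {n : ℕ} (u : (L n A)ˣ) (d : Fin n → ℤ) :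
    IsOpen {x : PrimeSpectrum A | ¬LexLT d (leadAt u x)} := by
  have : {x : PrimeSpectrum A | ¬LexLT d (leadAt u x)} = ⋃ l ∈ {l | ¬LexLT d l},
      (PrimeSpectrum.basicOpen (coeff n (u : L n A) l) : Set (PrimeSpectrum A)) := by
    ext x
    simp only [Set.mem_ofPred_eq, Set.mem_iUnion, SetLike.mem_coe, PrimeSpectrum.mem_basicOpen,
      ← coeff_red_eq_zero]
    constructor
    · exact fun h => ⟨_, h, (isLead_leadAt u x).1⟩
    · rintro ⟨l, hl, hl'⟩ h
      rcases LexLT.trichotomy l (leadAt u x) with h1 | h1 | h1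
      · exact hl' ((isLead_leadAt u x).2 l h1)
      · exact hl (h1 ▸ h)
      · exact hl (h.trans h1)
  rw [this]
  exact isOpen_biUnion fun l _ => PrimeSpectrum.isOpen_basicOpen

/-- Inversion negates the exponent, so semicontinuity for `u` and for `u⁻¹` makes both inequalities
with `d` open conditions. -/
theorem isLocallyConstant_leadAt {n : ℕ} (u : (L n A)ˣ) : IsLocallyConstant (leadAt u) := by
  rw [IsLocallyConstant.iff_isOpen_fiber]
  intro d
  have : leadAt u ⁻¹' {d} = {x | ¬LexLT d (leadAt u x)} ∩ {x | ¬LexLT (-d) (leadAt u⁻¹ x)} := by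
    ext x
    have h : LexLT (-d) (leadAt u⁻¹ x) ↔ LexLT (leadAt u x) d := by
      rw [leadAt_inv, lexLT_iff_sub, lexLT_iff_sub (a := leadAt u x), neg_sub_neg]
    simp only [Set.mem_preimage, Set.mem_singleton_iff, Set.mem_inter_iff, Set.mem_ofPred_eq, h]
    constructor
    · rintro rfl
      exact ⟨LexLT.irrefl _, LexLT.irrefl _⟩
    · rintro ⟨h1, h2⟩
      rcases LexLT.trichotomy d (leadAt u x) with h3 | h3 | h3
      · exact absurd h3 h1
      · exact h3.symm
      · exact absurd h3 h2
  rw [this]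
  exact (isOpen_not_lexLT_leadAt u d).inter (isOpen_not_lexLT_leadAt u⁻¹ (-d))

theorem isNilpotent_of_forall_mem {a : A} (h : ∀ x : PrimeSpectrum A, a ∈ x.asIdeal) :
    IsNilpotent a :=
  nilpotent_iff_mem_prime.2 fun J hJ => h ⟨J, hJ⟩

theorem isUnit_of_forall_notMem {a : A} (h : ∀ x : PrimeSpectrum A, a ∉ x.asIdeal) :
    IsUnit a := by
  by_contra ha
  obtain ⟨I, hI, haI⟩ := exists_max_ideal_of_mem_nonunits ha
  exact h ⟨I, hI.isPrime⟩ haI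

/-- A locally constant function on the spectrum of a ring comes from a decomposition of the
ring. -/
theorem exists_completeOrthogonalIdempotents {X : Type*}
    (v : LocallyConstant (PrimeSpectrum A) X) :
    ∃ (N : ℕ) (e : Fin N → A) (d : Fin N → X), CompleteOrthogonalIdempotents e ∧
      (∀ i x, e i ∉ x.asIdeal ↔ v x = d i) ∧ ∀ i, ∃ x, v x = d i := by
  have hfin : Finite (Set.range v) := (LocallyConstant.range_finite v).to_subtype
  obtain ⟨N, ⟨σ⟩⟩ := Finite.exists_equiv_fin (Set.range v)
  have hex : ∀ i : Fin N, ∃ e : A, IsIdempotentElem e ∧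
      ∀ x : PrimeSpectrum A, e ∉ x.asIdeal ↔ v x = σ.symm i := by
    intro i
    obtain ⟨e, he, h⟩ := PrimeSpectrum.isClopen_iff.1 (v.isLocallyConstant.isClopen_fiber (σ.symm i))
    exact ⟨e, he, fun x => (Set.ext_iff.1 h x).symm⟩
  choose e he hev using hex
  have hne : ∀ i j (x : PrimeSpectrum A), i ≠ j → e i ∉ x.asIdeal → e j ∈ x.asIdeal := by
    intro i j x hij hi
    by_contra hj
    rw [hev] at hi hj
    exact hij (σ.symm.injective (Subtype.ext (hi.symm.trans hj)))
  have horth : OrthogonalIdempotents e := by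
    refine ⟨he, fun i j hij => ?_⟩
    -- Idempotents are compared through primes: an idempotent lying in all primes is nilpotent,
    -- hence zero.
    refine ((he i).mul (he j)).eq_zero_of_isNilpotent (isNilpotent_of_forall_mem fun x => ?_)
    by_cases hi : e i ∈ x.asIdeal
    · exact Ideal.mul_mem_right _ _ hi
    · exact Ideal.mul_mem_left _ _ (hne i j x hij hi)
  refine ⟨N, e, fun i => σ.symm i, ⟨horth, ?_⟩, hev, fun i => (σ.symm i).2⟩
  refine (sub_eq_zero.1 (horth.isIdempotentElem_sum.one_sub.eq_zero_of_isNilpotent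
    (isNilpotent_of_forall_mem fun x => ?_))).symm
  have hi : e (σ ⟨v x, x, rfl⟩) ∉ x.asIdeal := by simp [hev]
  set i := σ ⟨v x, x, rfl⟩
  refine (x.2.mem_or_mem (x := e i) ?_).resolve_left hi
  rw [mul_sub, mul_one, Finset.mul_sum, Finset.sum_eq_single i
    (fun j _ hj => horth.ortho hj.symm) (by simp), (he i).eq, sub_self]
  exact x.asIdeal.zero_mem

theorem isValuation_leadAt {n : ℕ} (u : (L n A)ˣ) :
    IsValuation (u : L n A) ⟨leadAt u, isLocallyConstant_leadAt u⟩ := by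
  obtain ⟨N, e, d, he, hed, -⟩ :=
    exists_completeOrthogonalIdempotents ⟨leadAt u, isLocallyConstant_leadAt u⟩
  refine ⟨N, e, d, he, fun i => ⟨fun x => (hed i x).1, fun l hl => ?_, ?_⟩⟩
  · refine isNilpotent_of_forall_mem fun x => ?_
    by_cases hx : e i ∈ x.asIdeal
    · exact Ideal.mul_mem_right _ _ hx
    · have hd : leadAt u x = d i := (hed i x).1 hx
      refine Ideal.mul_mem_left _ _ (coeff_red_eq_zero.1 ((isLead_leadAt u x).2 l ?_))
      rwa [hd]
  · have hunit : IsUnit (e i * coeff n (u : L n A) (d i) + (1 - e i)) := by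
      refine isUnit_of_forall_notMem fun x hx => ?_
      have h0 : e i * (1 - e i) = 0 := by rw [mul_sub, mul_one, (he.idem i).eq, sub_self]
      by_cases hi : e i ∈ x.asIdeal
      · have h1 := (Ideal.add_mem_iff_right _ (Ideal.mul_mem_right _ _ hi)).1 hx
        exact x.2.one_notMem (by simpa using Ideal.add_mem _ h1 hi)
      · have hd : leadAt u x = d i := (hed i x).1 hi
        have h1 : 1 - e i ∈ x.asIdeal :=
          (x.2.mem_or_mem (by rw [h0]; exact x.asIdeal.zero_mem)).resolve_left hi
        have h2 := (x.2.mem_or_mem ((Ideal.add_mem_iff_left _ h1).1 hx)).resolve_left hi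
        exact (isLead_leadAt u x).1 (hd ▸ coeff_red_eq_zero.2 h2)
    obtain ⟨b, hb⟩ := hunit.exists_left_inv
    refine ⟨b, ?_⟩
    have h := congrArg (· * e i) hb
    have h1 := (he.idem i).eq
    simp only [one_mul] at h
    linear_combination h + (b * (1 - coeff n (u : L n A) (d i))) * h1

/-- Every valuation function of `u` must agree with `leadAt u`, so the choice made in `nu` is
immaterial. -/
theorem nu_apply {n : ℕ} (u : (L n A)ˣ) (x : PrimeSpectrum A) : nu u x = leadAt u x := by
  have hex : ∃ v, IsValuation (u : L n A) v := ⟨_, isValuation_leadAt u⟩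
  have hnu : IsValuation (u : L n A) (nu u) := by
    rw [nu, dif_pos hex]
    exact hex.choose_spec
  obtain ⟨N, e, d, he, h⟩ := hnu
  obtain ⟨i, hi⟩ : ∃ i, e i ∉ x.asIdeal := by
    by_contra! h
    refine x.2.one_notMem ?_
    rw [← he.complete]
    exact Ideal.sum_mem _ fun i _ => h i
  obtain ⟨h1, h2, b, hb⟩ := h i
  rw [h1 x hi, eq_comm, leadAt_eq_iff]
  refine ⟨fun h0 => hi ?_, fun l hl => coeff_red_eq_zero.2 ?_⟩
  · rw [← hb]
    exact Ideal.mul_mem_left _ _ (Ideal.mul_mem_left _ _ (coeff_red_eq_zero.1 h0))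
  · obtain ⟨k, hk⟩ := h2 l hl
    refine (x.2.mem_or_mem (x.2.mem_of_pow_mem k ?_)).resolve_left hi
    rw [hk]
    exact x.asIdeal.zero_mem

theorem mem_H_iff {m n : ℕ} {φ : Fin n → (L m A)ˣ} : φ ∈ H m n A ↔
    ∀ x : PrimeSpectrum A, IsPosEchelon (Matrix.of fun i j => leadAt (φ j) x i) := by
  refine forall_congr' fun x => ?_
  have : ((valMatrix φ).map fun v => v x) = Matrix.of fun i j => leadAt (φ j) x i := by
    ext i j
    simp [valMatrix, nu_apply]
  rw [this]

end Spec


/-! ### Units of valuation zero and the supports of their powers -/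

section Units

variable {A : Type u} [CommRing A]

/-- The series `c t_{n+1}^k`, where `c` is a series in the first `n` variables. -/
noncomputable def mono {n : ℕ} (k : ℤ) (c : L n A) : L (n + 1) A :=
  (toSeries n).symm (HahnSeries.single k c)

theorem slice_mono {n : ℕ} (k : ℤ) (c : L n A) (j : ℤ) :
    slice (mono k c) j = if j = k then c else 0 := by
  rw [slice, mono, RingEquiv.apply_symm_apply, HahnSeries.coeff_single]
  congr

theorem mono_pow {n : ℕ} (k : ℤ) (c : L n A) (j : ℕ) : mono k c ^ j = mono (j • k) (c ^ j) := by
  rw [mono, ← map_pow, HahnSeries.single_pow]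
  rfl

theorem isNilpotent_mono {n : ℕ} (k : ℤ) {c : L n A} (hc : IsNilpotent c) :
    IsNilpotent (mono k c) := by
  obtain ⟨j, hj⟩ := hc
  refine ⟨j, ?_⟩
  rw [mono_pow, hj, mono, HahnSeries.single_eq_zero, map_zero]

theorem slice_sum {n : ℕ} {ι : Type*} (s : Finset ι) (f : ι → L (n + 1) A) (k : ℤ) :
    slice (∑ i ∈ s, f i) k = ∑ i ∈ s, slice (f i) k := by
  rw [slice, map_sum, HahnSeries.coeff_sum]
  rfl

theorem slice_sub {n : ℕ} (f g : L (n + 1) A) (k : ℤ) :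
    slice (f - g) k = slice f k - slice g k := rfl

/-- Only finitely many negative slices are non-zero, so their nilpotent contributions add up to a
nilpotent `y`. -/
theorem exists_eq_add_add {n : ℕ} {f : L (n + 1) A} (h : ∀ k < 0, IsNilpotent (slice f k)) :
    ∃ y z, f = y + mono 0 (slice f 0) + z ∧ IsNilpotent y ∧ ∀ k ≤ 0, slice z k = 0 := by
  obtain ⟨N, hN⟩ := exists_slice_eq_zero f
  refine ⟨∑ k ∈ Finset.Ico N 0, mono k (slice f k),
    f - (∑ k ∈ Finset.Ico N 0, mono k (slice f k) + mono 0 (slice f 0)), by ring, ?_, ?_⟩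
  · exact isNilpotent_sum fun k hk => isNilpotent_mono k (h k (Finset.mem_Ico.1 hk).2)
  · intro k hk
    rw [slice_sub, slice_add, slice_sum]
    simp only [slice_mono]
    rw [Finset.sum_ite_eq]
    rcases hk.eq_or_lt with rfl | hk
    · simp
    · by_cases hkN : N ≤ k
      · simp [hk.ne, hk, hkN]
      · simp [hk.ne, hkN, hN k (not_le.1 hkN)]

/-- The geometric series in `z` is summable. -/
theorem isUnit_one_sub_of_pos {n : ℕ} {z : L (n + 1) A} (h : ∀ k ≤ 0, slice z k = 0) :
    IsUnit (1 - z) := by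
  have h0 : 0 < (toSeries n z).orderTop := by
    by_contra! hle
    have hz : toSeries n z ≠ 0 := by
      intro h0
      simp [h0] at hle
    have h1 := HahnSeries.order_eq_orderTop_of_ne_zero hz
    rw [← h1] at hle
    exact hz (HahnSeries.coeff_order_eq_zero.1 (h _ (by exact_mod_cast hle)))
  have h1 := IsUnit.of_mul_eq_one _ (HahnSeries.SummableFamily.one_sub_self_mul_hsum_powers h0)
  rw [← map_one (toSeries n), ← map_sub] at h1
  exact (MulEquiv.isUnit_map (toSeries n)).1 h1

/-- Laurent series over the domain `A ⧸ P` form a domain, whose only idempotents are 0 and 1. -/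
theorem coeff_mem_of_isIdempotentElem (P : PrimeSpectrum A) {f : LaurentSeries A}
    (hf : IsIdempotentElem f) :
    (∀ k, f.coeff k ∈ P.asIdeal) ∨
      (∀ k ≠ 0, f.coeff k ∈ P.asIdeal) ∧ f.coeff 0 - 1 ∈ P.asIdeal := by
  simp only [← Ideal.Quotient.eq_zero_iff_mem, ← coeff_mapSeries, map_sub, map_one]
  have h := hf.map (mapSeries (Ideal.Quotient.mk P.asIdeal))
  rcases IsIdempotentElem.iff_eq_zero_or_one.1 h with h | h
  · exact Or.inl fun k => by rw [h, HahnSeries.coeff_zero]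
  · refine Or.inr ⟨fun k hk => ?_, ?_⟩
    · rw [h, HahnSeries.coeff_one, if_neg hk]
    · rw [h, HahnSeries.coeff_one, if_pos rfl, sub_self]

/-- Idempotents of `Lⁿ(A)` are detected by the primes of `A` alone, although `Lⁿ(A)` may have many
other primes. Modulo nilpotents, `e` is its zeroth slice, itself an idempotent there; this lifts to
a true idempotent, which vanishes by induction. Then `1 - e` is a unit that annihilates `e`. -/
theorem eq_zero_of_isIdempotentElem {n : ℕ} {e : L n A} (he : IsIdempotentElem e)
    (h : ∀ x : PrimeSpectrum A, red x n e = 0) : e = 0 := by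
  induction n with
  | zero =>
    refine IsIdempotentElem.eq_zero_of_isNilpotent he (isNilpotent_of_forall_mem fun x => ?_)
    exact Ideal.Quotient.eq_zero_iff_mem.1 (h x)
  | succ n ih =>
    have hP := fun P : PrimeSpectrum (L n A) => coeff_mem_of_isIdempotentElem P (he.map (toSeries n))
    have hnil : ∀ k ≠ 0, IsNilpotent (slice e k) := fun k hk =>
      isNilpotent_of_forall_mem fun P => (hP P).elim (fun h => h k) fun h => h.1 k hk
    have h0 : IsNilpotent (slice e 0 * slice e 0 - slice e 0) := by
      refine isNilpotent_of_forall_mem fun P => ?_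
      rw [← mul_sub_one]
      exact (hP P).elim (fun h => Ideal.mul_mem_right _ _ (h 0)) fun h =>
        Ideal.mul_mem_left _ _ h.2
    obtain ⟨e', he', hee'⟩ := exists_isIdempotentElem_eq_of_ker_isNilpotent
      (Ideal.Quotient.mk (nilradical (L n A)))
      (fun x hx => mem_nilradical.1 (by rwa [Ideal.mk_ker] at hx))
      (Ideal.Quotient.mk _ (slice e 0)) ⟨_, rfl⟩ (by
        rw [IsIdempotentElem, ← map_mul]
        exact Ideal.Quotient.eq.2 h0)
    have hsub : IsNilpotent (e' - slice e 0) := Ideal.Quotient.eq.1 hee'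
    have h0' : IsNilpotent (slice e 0) := by
      have : e' = 0 := ih he' fun x => by
        -- The target of `red x n` is a domain, so the nilpotent difference vanishes there.
        have h1 := (hsub.map (red x n)).eq_zero
        rwa [map_sub, ← slice_mapL, h x, slice_zero, sub_zero] at h1
      rw [this, zero_sub] at hsub
      simpa using hsub
    obtain ⟨y, z, hyz, hy, hz⟩ := exists_eq_add_add (f := e) fun k hk => hnil k hk.ne
    have hunit : IsUnit (1 - e) := by
      have hy' := (Commute.all _ _).isNilpotent_add hy (isNilpotent_mono 0 h0')
      have := (hy'.neg).isUnit_add_left_of_commute (isUnit_one_sub_of_pos hz) (Commute.all _ _)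
      convert this using 1
      conv_lhs => rw [hyz]
      ring
    refine hunit.mul_right_eq_zero.1 ?_
    rw [sub_mul, one_mul, he.eq, sub_self]

/-- `L¹(R)` as the ring of Laurent series over `R`. -/
noncomputable def oneEquiv (R : Type u) [CommRing R] : L 1 R ≃+* LaurentSeries R where
  toFun f := f
  invFun f := f
  left_inv _ := rfl
  right_inv _ := rfl
  map_mul' _ _ := rfl
  map_add' _ _ := rfl

/-- The assumption concerns primes of `A`, but the conclusion needs all primes of `R = Lⁿ(A)`.
Regard `u` as a unit `w` of `L¹(R)`: the locus in `Spec R` where its valuation is non-zero is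
clopen, and the idempotent cutting it out vanishes by `eq_zero_of_isIdempotentElem`. -/
theorem slice_of_leadAt_eq_zero {n : ℕ} {u : (L (n + 1) A)ˣ}
    (hu : ∀ x : PrimeSpectrum A, leadAt u x = 0) :
    (∀ k < 0, IsNilpotent (slice (u : L (n + 1) A) k)) ∧ IsUnit (slice (u : L (n + 1) A) 0) := by
  have hlead := fun x => isLead_succ.1 (leadAt_eq_iff.1 (hu x))
  let w : (L 1 (L n A))ˣ :=
    Units.mapEquiv ((toSeries n).trans (oneEquiv (L n A)).symm).toMulEquiv u
  have hw : ∀ l, coeff 1 (w : L 1 (L n A)) l = slice (u : L (n + 1) A) (l (Fin.last 0)) :=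
    fun l => rfl
  have key : ∀ P, leadAt w P = 0 := by
    obtain ⟨e, he, hew⟩ := PrimeSpectrum.isClopen_iff.1
      ((isLocallyConstant_leadAt w).isClopen_fiber 0).compl
    have hmem : ∀ P, leadAt w P ≠ 0 ↔ e ∉ P.asIdeal := fun P => Set.ext_iff.1 hew P
    have he0 : e = 0 := by
      refine eq_zero_of_isIdempotentElem he fun x => ?_
      -- This kernel is a point of `Spec R` at which `w` has valuation zero, so it must contain the
      -- idempotent `e`.
      have : (RingHom.ker (red x n)).IsPrime := RingHom.ker_isPrime _
      by_contra hne
      refine (hmem ⟨RingHom.ker (red x n), this⟩).2 hne (leadAt_eq_iff.2 ⟨?_, fun l hl => ?_⟩)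
      · rw [Ne, coeff_red_eq_zero, hw]
        exact (hlead x).2.ne_zero
      · rw [coeff_red_eq_zero, hw]
        refine (hlead x).1 _ ?_
        obtain ⟨i, hi, -⟩ := hl
        rwa [Subsingleton.elim i (Fin.last 0)] at hi
    intro P
    by_contra h
    exact (hmem P).1 h (he0 ▸ P.asIdeal.zero_mem)
  have hw' := fun P => leadAt_eq_iff.1 (key P)
  constructor
  · refine fun k hk => isNilpotent_of_forall_mem fun P => ?_
    refine coeff_red_eq_zero.1 ((hw' P).2 (fun _ => k) ⟨Fin.last 0, hk, fun j hj => ?_⟩)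
    exact absurd (Subsingleton.elim _ _) hj.ne
  · exact isUnit_of_forall_notMem fun P hP => (hw' P).1 (coeff_red_eq_zero.2 hP)

/-- The supports of all powers of `f` lie in one admissible set. -/
def PowerBounded {n : ℕ} (f : L n A) : Prop := ∃ T, Adm n T ∧ ∀ k : ℕ, supp (f ^ k) ⊆ T

theorem supp_nsmul_subset {n : ℕ} (c : ℕ) (f : L n A) : supp (c • f) ⊆ supp f := by
  intro l hl h
  refine hl ?_
  rw [← coeffHom_apply, map_nsmul, coeffHom_apply, h, smul_zero]

/-- By the binomial formula, all powers have supports in the sum of the two bounding sets. -/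
theorem PowerBounded.add {n : ℕ} {f g : L n A} (hf : PowerBounded f) (hg : PowerBounded g) :
    PowerBounded (f + g) := by
  obtain ⟨S, hS, hfS⟩ := hf
  obtain ⟨T, hT, hgT⟩ := hg
  refine ⟨S + T, hS.add hT, fun k => ?_⟩
  rw [(Commute.all f g).add_pow']
  refine supp_sum_subset _ _ fun i _ => (supp_nsmul_subset _ _).trans ?_
  exact (supp_mul_subset _ _).trans (Set.add_subset_add (hfS _) (hgT _))

theorem PowerBounded.of_isNilpotent {n : ℕ} {f : L n A} (hf : IsNilpotent f) :
    PowerBounded f := by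
  obtain ⟨N, hN⟩ := hf
  refine ⟨_, Adm.biUnion (Set.finite_Iio N) fun k _ => adm_supp (f ^ k), fun k l hl => ?_⟩
  simp only [Set.mem_iUnion]
  refine ⟨k, ?_, hl⟩
  by_contra h
  exact hl (by rw [pow_eq_zero_of_le (not_lt.1 h) hN, coeff_zero])

theorem PowerBounded.mono_zero {n : ℕ} {c : L n A} (hc : PowerBounded c) :
    PowerBounded (mono 0 c) := by
  obtain ⟨T, hT, hcT⟩ := hc
  refine ⟨{l | l (Fin.last n) = 0 ∧ Fin.init l ∈ T}, ⟨⟨0, fun l hl => hl.1.ge⟩, fun k =>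
    hT.mono fun l hl => by simpa using hl.2⟩, fun k l hl => ?_⟩
  rw [mono_pow, smul_zero, mem_supp, coeff_succ, slice_mono] at hl
  split_ifs at hl with h
  · exact ⟨h, hcT k hl⟩
  · exact absurd (coeff_zero _) hl

/-- The power `z ^ k` lives in levels at least `k`, so each level meets only finitely many powers.
-/
theorem PowerBounded.of_pos {n : ℕ} {z : L (n + 1) A} (h : ∀ k ≤ 0, slice z k = 0) :
    PowerBounded z := by
  have hz : ∀ (k : ℕ) (l), l ∈ supp (z ^ k) → (k : ℤ) ≤ l (Fin.last n) := by
    intro k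
    induction k with
    | zero =>
      intro l hl
      rw [pow_zero] at hl
      rw [supp_one_subset _ hl]
      simp
    | succ k ih =>
      intro l hl
      rw [pow_succ] at hl
      obtain ⟨a, ha, b, hb, rfl⟩ := supp_mul_subset _ _ hl
      have hb' : 0 < b (Fin.last n) := by
        by_contra! hle
        exact hb (by rw [coeff_succ, h _ hle, coeff_zero])
      have := ih a ha
      simp only [Pi.add_apply]
      push_cast
      linarith
  refine ⟨⋃ k : ℕ, supp (z ^ k), ⟨⟨0, fun l hl => ?_⟩, fun j => ?_⟩, fun k =>
    Set.subset_iUnion_of_subset k subset_rfl⟩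
  · obtain ⟨k, hk⟩ := Set.mem_iUnion.1 hl
    exact (Int.natCast_nonneg k).trans (hz k l hk)
  · refine (Adm.biUnion (Set.finite_Iic j.toNat)
      fun k _ => adm_supp (slice (z ^ k) j)).mono fun l hl => ?_
    obtain ⟨k, hk⟩ := Set.mem_iUnion.1 hl
    have := hz k _ hk
    rw [push_last] at this
    simp only [Set.mem_iUnion]
    exact ⟨k, by rw [Set.mem_Iic]; omega, push_mem_supp.1 hk⟩

/-- Such a unit is a sum of a nilpotent series, a unit of valuation zero in fewer variables, and a
series of positive order in the last variable. Each summand is power bounded, the middle one by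
induction. -/
theorem PowerBounded.of_leadAt {n : ℕ} {u : (L n A)ˣ}
    (hu : ∀ x : PrimeSpectrum A, leadAt u x = 0) : PowerBounded (u : L n A) := by
  induction n with
  | zero => exact ⟨Set.univ, trivial, fun _ => Set.subset_univ _⟩
  | succ n ih =>
    obtain ⟨h1, c, hc⟩ := slice_of_leadAt_eq_zero hu
    obtain ⟨y, z, hyz, hy, hz⟩ := exists_eq_add_add h1
    have hcb : PowerBounded (c : L n A) := ih fun x => by
      rw [leadAt_eq_iff, hc, ← slice_mapL]
      exact (isLead_succ.1 (leadAt_eq_iff.1 (hu x))).2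
    rw [hyz, ← hc]
    exact ((PowerBounded.of_isNilpotent hy).add hcb.mono_zero).add (PowerBounded.of_pos hz)

theorem exists_supp_zpow_subset {n : ℕ} {u : (L n A)ˣ}
    (hu : ∀ x : PrimeSpectrum A, leadAt u x = 0) :
    ∃ T, Adm n T ∧ ∀ k : ℤ, supp ((u ^ k : (L n A)ˣ) : L n A) ⊆ T := by
  obtain ⟨S, hS, huS⟩ := PowerBounded.of_leadAt hu
  obtain ⟨T, hT, huT⟩ := PowerBounded.of_leadAt (u := u⁻¹) fun x => by
    rw [leadAt_inv, hu, neg_zero]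
  refine ⟨S ∪ T, hS.union hT, fun k => ?_⟩
  obtain ⟨j, rfl | rfl⟩ := k.eq_nat_or_neg
  · rw [zpow_natCast, Units.val_pow_eq_pow_val]
    exact (huS j).trans Set.subset_union_left
  · rw [zpow_neg, ← inv_zpow, zpow_natCast, Units.val_pow_eq_pow_val]
    exact (huT j).trans Set.subset_union_right

theorem exists_supp_prod_zpow_subset {m n : ℕ} {u : Fin n → (L m A)ˣ}
    (hu : ∀ i (x : PrimeSpectrum A), leadAt (u i) x = 0) :
    ∃ T, Adm m T ∧ ∀ l : Fin n → ℤ, supp ((∏ i, u i ^ l i : (L m A)ˣ) : L m A) ⊆ T := by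
  induction n with
  | zero => exact ⟨{0}, Adm.singleton 0, fun l => by simpa using supp_one_subset m⟩
  | succ n ih =>
    obtain ⟨S, hS, h⟩ := ih (u := fun i => u i.castSucc) fun i => hu _
    obtain ⟨T, hT, h'⟩ := exists_supp_zpow_subset (hu (Fin.last n))
    refine ⟨S + T, hS.add hT, fun l => ?_⟩
    rw [Fin.prod_univ_castSucc, Units.val_mul]
    exact (supp_mul_subset _ _).trans (Set.add_subset_add (h fun i => l i.castSucc) (h' _))

end Units


/-! ### Evaluation at a collection from `H` -/

section Evaluation

variable {A : Type u} [CommRing A]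

/-- The unit that equals `u` on the component of `A` cut out by an idempotent `e` and `1` on the
other one. -/
noncomputable def glue {n : ℕ} {e : A} (he : IsIdempotentElem e) (u : (L n A)ˣ) : (L n A)ˣ where
  val := e • (u : L n A) + (1 - e) • 1
  inv := e • ((u⁻¹ : (L n A)ˣ) : L n A) + (1 - e) • 1
  val_inv := by
    have h := u.mul_inv
    have he' := congrArg (algebraMap A (L n A)) he.eq
    simp only [Algebra.smul_def, map_sub, map_one, map_mul] at he' ⊢
    generalize ((u⁻¹ : (L n A)ˣ) : L n A) = v at *
    generalize algebraMap A (L n A) e = a at *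
    linear_combination (u * v + 1 - u - v) * he' + a * h
  inv_val := by
    have h := u.mul_inv
    have he' := congrArg (algebraMap A (L n A)) he.eq
    simp only [Algebra.smul_def, map_sub, map_one, map_mul] at he' ⊢
    generalize ((u⁻¹ : (L n A)ˣ) : L n A) = v at *
    generalize algebraMap A (L n A) e = a at *
    linear_combination (u * v + 1 - u - v) * he' + a * h

theorem coe_glue {n : ℕ} {e : A} (he : IsIdempotentElem e) (u : (L n A)ˣ) :
    (glue he u : L n A) = e • (u : L n A) + (1 - e) • 1 := rfl

theorem red_smul_eq_zero {n : ℕ} {x : PrimeSpectrum A} {a : A} (ha : a ∈ x.asIdeal) (f : L n A) :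
    red x n (a • f) = 0 := by
  refine coeff_ext fun l => ?_
  rw [coeff_zero, coeff_red_eq_zero, coeff_smul]
  exact Ideal.mul_mem_right _ _ ha

theorem leadAt_glue {n : ℕ} {e : A} (he : IsIdempotentElem e) {u : (L n A)ˣ}
    (hu : ∀ x : PrimeSpectrum A, e ∉ x.asIdeal → leadAt u x = 0) (x : PrimeSpectrum A) :
    leadAt (glue he u) x = 0 := by
  rw [leadAt_eq_iff, coe_glue, map_add]
  by_cases hx : e ∈ x.asIdeal
  · rw [red_smul_eq_zero hx, sub_smul, map_sub, red_smul_eq_zero hx, one_smul, map_one, sub_zero,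
      zero_add]
    exact isLead_one n
  · have hx' : 1 - e ∈ x.asIdeal := by
      refine (x.2.mem_or_mem (x := e) ?_).resolve_left hx
      rw [mul_sub, mul_one, he.eq, sub_self]
      exact x.asIdeal.zero_mem
    have h : e • (u : L n A) = u - (1 - e) • (u : L n A) := by
      rw [sub_smul, one_smul, sub_sub_cancel]
    rw [red_smul_eq_zero hx', h, map_sub, red_smul_eq_zero hx', sub_zero, add_zero]
    exact leadAt_eq_iff.1 (hu x hx)

/-- The glued units agree with the `u i` modulo the ideal generated by `1 - e`, which `e`
annihilates. -/
theorem smul_prod_glue {m n : ℕ} {e : A} (he : IsIdempotentElem e) (u : Fin n → (L m A)ˣ)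
    (l : Fin n → ℤ) : e • ((∏ i, glue he (u i) ^ l i : (L m A)ˣ) : L m A) =
      e • ((∏ i, u i ^ l i : (L m A)ˣ) : L m A) := by
  let I : Ideal (L m A) := Ideal.span {algebraMap A (L m A) (1 - e)}
  let q : (L m A)ˣ →* (L m A ⧸ I)ˣ := Units.map (Ideal.Quotient.mk I : L m A →* L m A ⧸ I)
  have hq : ∀ i, q (glue he (u i)) = q (u i) := by
    intro i
    refine Units.ext (Ideal.Quotient.eq.2 (Ideal.mem_span_singleton.2
      ⟨1 - (u i : L m A), ?_⟩))
    rw [coe_glue, sub_smul, one_smul, map_sub, map_one, Algebra.smul_def, Algebra.smul_def]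
    ring
  have h : q (∏ i, glue he (u i) ^ l i) = q (∏ i, u i ^ l i) := by
    simp only [map_prod, map_zpow, hq]
  obtain ⟨c, hc⟩ := Ideal.mem_span_singleton.1 (Ideal.Quotient.eq.1 (Units.ext_iff.1 h))
  rw [← sub_eq_zero, ← smul_sub]
  refine (congrArg (e • ·) hc).trans ?_
  rw [Algebra.smul_def, ← mul_assoc, ← map_mul, mul_sub, mul_one, he.eq, sub_self, map_zero,
    zero_mul]

theorem prod_zpow_eq {m n : ℕ} (φ : Fin n → (L m A)ˣ) (d : Fin n → Fin m → ℤ) (l : Fin n → ℤ) :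
    ∏ i, φ i ^ l i = (∏ i, (φ i * monomialUnit A (-d i)) ^ l i) *
      monomialUnit A ((Matrix.of fun i j => d j i).mulVec l) := by
  have h : (Matrix.of fun i j => d j i).mulVec l = ∑ j, l j • d j := by
    ext i
    simp [Matrix.mulVec, dotProduct, mul_comm]
  rw [h, monomialUnit_sum, ← Finset.prod_mul_distrib]
  refine Finset.prod_congr rfl fun j _ => ?_
  rw [monomialUnit_zsmul, ← mul_zpow, mul_assoc, ← monomialUnit_add, neg_add_cancel,
    monomialUnit_zero, mul_one]

/-- The set `T` is uniform in `l`: after the monomials `t^(d j)` are split off and the component of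
`1 - e` is filled with 1, the remaining units have valuation zero at all primes. -/
theorem exists_supp_smul_prod_subset {m n : ℕ} {φ : Fin n → (L m A)ˣ} {e : A}
    (he : IsIdempotentElem e) {d : Fin n → Fin m → ℤ}
    (hd : ∀ (x : PrimeSpectrum A), e ∉ x.asIdeal → ∀ j, leadAt (φ j) x = d j) :
    ∃ T, Adm m T ∧ ∀ l : Fin n → ℤ, supp (e • ((∏ i, φ i ^ l i : (L m A)ˣ) : L m A)) ⊆
      T + {(Matrix.of fun i j => d j i).mulVec l} := by
  obtain ⟨T, hT, h⟩ := exists_supp_prod_zpow_subset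
    (u := fun j => glue he (φ j * monomialUnit A (-d j))) fun j => leadAt_glue he fun x hx => by
      have : leadAt (monomialUnit A (-d j)) x = -d j := by
        rw [leadAt_eq_iff]
        refine ⟨?_, fun l hl => ?_⟩
        · rw [coeff_mapL, coe_monomialUnit, coeff_monomial, if_pos rfl, map_one]
          exact one_ne_zero
        · rw [coeff_mapL, coe_monomialUnit, coeff_monomial, if_neg, map_zero]
          rintro rfl
          exact LexLT.irrefl _ hl
      rw [leadAt_mul, hd x hx, this, add_neg_cancel]
  refine ⟨T, hT, fun l => ?_⟩
  rw [prod_zpow_eq φ d, Units.val_mul, ← smul_mul_assoc, ← smul_prod_glue he]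
  exact (supp_mul_subset _ _).trans (Set.add_subset_add
    ((supp_smul_subset _ _).trans (h l)) (supp_monomial_subset _))

/-- The monomials in a collection of series from `H` tend to zero. -/
theorem exists_prod_zpow_mem_V {m n : ℕ} {φ : Fin n → (L m A)ˣ} (hφ : φ ∈ H m n A)
    (S : Set (Fin m → ℤ)) (hS : Adm m S) : ∃ T, Adm n T ∧ ∀ l : Fin n → ℤ, -l ∉ T →
      ((∏ i, φ i ^ l i : (L m A)ˣ) : L m A) ∈ V S := by
  -- The `n` valuations are bundled into one locally constant function, so that a single
  -- decomposition of `A` makes all of them constant.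
  obtain ⟨N, e, d, he, hed, hd⟩ := exists_completeOrthogonalIdempotents
    (LocallyConstant.unflip fun j => ⟨leadAt (φ j), isLocallyConstant_leadAt (φ j)⟩)
  choose T hT hφT using fun i => exists_supp_smul_prod_subset (φ := φ) (he.idem i) (d := d i)
    fun x hx => congrFun ((hed i x).1 hx)
  have hM : ∀ i, IsPosEchelon (Matrix.of fun k j => d i j k) := by
    intro i
    obtain ⟨x, hx⟩ := hd i
    rw [← hx]
    exact mem_H_iff.1 hφ x
  refine ⟨_, Adm.biUnion (Set.toFinite (Set.univ : Set (Fin N))) fun i _ =>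
    (hS.add (hT i)).preimage_mulVec (hM i), fun l hl r hr => ?_⟩
  rw [← one_smul A ((∏ i, φ i ^ l i : (L m A)ˣ) : L m A), ← he.complete, Finset.sum_smul,
    coeff_sum]
  refine Finset.sum_eq_zero fun i _ => ?_
  by_contra h
  -- A non-zero coefficient gives `a + M l = -r`, that is, `M (-l) = r + a` lies in `S + T i`, so
  -- `-l` would be in the excluded set.
  obtain ⟨a, ha, b, rfl, hab⟩ := hφT i l h
  refine hl (Set.mem_biUnion (Set.mem_univ i) ⟨r, hr, a, ha, ?_⟩)
  have hab : a + _ = -r := hab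
  simp only
  rw [Matrix.mulVec_neg, eq_neg_iff_add_eq_zero, add_assoc, hab, add_neg_cancel]

instance (n : ℕ) : ContinuousConstSMul A (L n A) :=
  ⟨fun a => continuous_of_linear (DistribSMul.toAddMonoidHom (L n A) a) fun S hS =>
    ⟨S, hS, fun _ hf => smul_mem_V hf a⟩⟩

/-- Every series is the sum of its monomial terms in the topology of `Lⁿ(A)`. -/
theorem linearMap_ext_monomial {m n : ℕ} {F G : L n A →ₗ[A] L m A} (hF : Continuous F)
    (hG : Continuous G) (h : ∀ l, F (monomial A n l) = G (monomial A n l)) : F = G := by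
  ext f
  have h1 := (hasSum_monomial f).map F hF
  have h2 := (hasSum_monomial f).map G hG
  refine h1.unique ?_
  convert h2 using 1
  ext l
  simp [h]

section

variable {m n : ℕ} {φ : Fin n → (L m A)ˣ} (hφ : φ ∈ H m n A)

/-- The evaluation of iterated Laurent series at a collection from `H`, as a linear map. -/
noncomputable def evalLin : L n A →ₗ[A] L m A where
  toFun f := (exists_hasSum _ (exists_prod_zpow_mem_V hφ) f).choose
  map_add' f g := by
    have h := fun f => (exists_hasSum _ (exists_prod_zpow_mem_V hφ) f).choose_spec
    refine (h (f + g)).unique ?_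
    simp only [coeff_add, add_smul]
    exact (h f).add (h g)
  map_smul' a f := by
    have h := fun f => (exists_hasSum _ (exists_prod_zpow_mem_V hφ) f).choose_spec
    refine (h (a • f)).unique ?_
    simp only [coeff_smul, mul_smul]
    exact (h f).const_smul a

theorem hasSum_evalLin (f : L n A) :
    HasSum (fun l => coeff n f l • ((∏ i, φ i ^ l i : (L m A)ˣ) : L m A)) (evalLin hφ f) :=
  (exists_hasSum _ (exists_prod_zpow_mem_V hφ) f).choose_spec

theorem evalLin_monomial (l : Fin n → ℤ) :
    evalLin hφ (monomial A n l) = ((∏ i, φ i ^ l i : (L m A)ˣ) : L m A) := by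
  refine (hasSum_evalLin hφ _).unique ?_
  convert hasSum_single l ?_ using 1
  · rw [coeff_monomial, if_pos rfl, one_smul]
  · intro l' hl'
    rw [coeff_monomial, if_neg hl', zero_smul]

/-- For `f` in `V T`, the terms with `-l ∈ T` vanish, and the others lie in `V S` by the choice of
`T`. -/
theorem continuous_evalLin : Continuous (evalLin hφ) := by
  refine continuous_of_linear (evalLin hφ).toAddMonoidHom fun S hS => ?_
  obtain ⟨T, hT, h⟩ := exists_prod_zpow_mem_V hφ S hS
  refine ⟨T, hT, fun f hf => mem_V_of_hasSum (hasSum_evalLin hφ f) hS fun l => ?_⟩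
  by_cases hl : -l ∈ T
  · have := hf _ hl
    rw [neg_neg] at this
    rw [this, zero_smul]
    exact (V S).zero_mem
  · exact smul_mem_V (h l hl) _

/-- Separate continuity of multiplication suffices: density of monomials is used first in `f` with
the other factor a monomial, then in `g` with `f` fixed. -/
theorem evalLin_mul (f g : L n A) : evalLin hφ (f * g) = evalLin hφ f * evalLin hφ g := by
  have hl : ∀ {k : ℕ} (h : L k A), Continuous fun f => h * f := fun h => by
    simpa only [mul_comm h] using continuous_mul_const h
  have h1 : ∀ l f, evalLin hφ (f * monomial A n l) = evalLin hφ f * evalLin hφ (monomial A n l) := by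
    intro l
    refine LinearMap.congr_fun (linearMap_ext_monomial
      (F := evalLin hφ ∘ₗ LinearMap.mulRight A (monomial A n l))
      (G := LinearMap.mulRight A (evalLin hφ (monomial A n l)) ∘ₗ evalLin hφ)
      ((continuous_evalLin hφ).comp (continuous_mul_const _))
      ((continuous_mul_const _).comp (continuous_evalLin hφ)) fun l' => ?_)
    simp only [LinearMap.comp_apply, LinearMap.mulRight_apply, ← monomial_add, evalLin_monomial,
      ← Units.val_mul, ← Finset.prod_mul_distrib, ← zpow_add]
    rfl
  exact LinearMap.congr_fun (linearMap_ext_monomial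
    (F := evalLin hφ ∘ₗ LinearMap.mulLeft A f)
    (G := LinearMap.mulLeft A (evalLin hφ f) ∘ₗ evalLin hφ)
    ((continuous_evalLin hφ).comp (hl _)) ((hl _).comp (continuous_evalLin hφ))
    fun l => h1 l f) g

/-- The evaluation of iterated Laurent series at a collection from `H`. -/
noncomputable def eval : L n A →A[A] L m A where
  toAlgHom := AlgHom.ofLinearMap (evalLin hφ)
    (by rw [← monomial_zero, evalLin_monomial]; simp) (evalLin_mul hφ)
  cont := continuous_evalLin hφ

end

end Evaluation

/-! ### Continuous homomorphisms and the bijection -/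

section Homomorphisms

variable {A : Type u} [CommRing A] {m n : ℕ}

theorem tendsto_monomial {δ : Fin n → ℤ} (hδ : LexLT 0 δ) :
    Filter.Tendsto (fun k : ℕ => monomial A n ((k : ℤ) • δ)) Filter.atTop (nhds 0) := by
  refine tendsto_iff.2 fun S hS => ?_
  rw [← Nat.cofinite_eq_atTop, Filter.eventually_cofinite]
  have hinj : Function.Injective fun k : ℕ => (k : ℤ) • δ := by
    obtain ⟨i, hi, -⟩ := hδ
    intro a b hab
    have := congrFun hab i
    simp only [Pi.smul_apply, smul_eq_mul] at this
    exact_mod_cast mul_right_cancel₀ hi.ne' this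
  have hadm : Adm n (Set.range fun k : ℕ => (k : ℤ) • δ) :=
    adm_multiples fun h => LexLT.irrefl _ (hδ.trans h)
  refine ((hadm.finite_inter_neg hS).preimage hinj.injOn).subset fun k hk => ⟨⟨k, rfl⟩, ?_⟩
  by_contra h
  refine hk fun l hl => ?_
  rw [sub_zero, coeff_monomial, if_neg]
  intro h'
  refine h ?_
  simpa only [Set.mem_neg, ← h', neg_neg] using hl

/-- The unit that is the image of the monomial `t^l`. -/
noncomputable def imageUnit (ϕ : L n A →A[A] L m A) (l : Fin n → ℤ) : (L m A)ˣ :=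
  Units.map (MonoidHomClass.toMonoidHom ϕ) (monomialUnit A l)

theorem imageUnit_add (ϕ : L n A →A[A] L m A) (l l' : Fin n → ℤ) :
    imageUnit ϕ (l + l') = imageUnit ϕ l * imageUnit ϕ l' := by
  rw [imageUnit, monomialUnit_add, map_mul]
  rfl

theorem imageUnit_eq_prod (ϕ : L n A →A[A] L m A) (l : Fin n → ℤ) :
    imageUnit ϕ l = ∏ i, imageUnit ϕ (Pi.single i 1) ^ l i := by
  rw [imageUnit, monomialUnit_eq_prod, map_prod]
  simp only [map_zpow]
  rfl

/-- The map of exponents that a continuous homomorphism induces at a point of the spectrum. -/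
noncomputable def leadMap (ϕ : L n A →A[A] L m A) (x : PrimeSpectrum A) :
    (Fin n → ℤ) →+ (Fin m → ℤ) :=
  AddMonoidHom.mk' (fun l => leadAt (imageUnit ϕ l) x) fun l l' => by
    rw [imageUnit_add, leadAt_mul]

/-- If the exponent `δ'` of `ϕ(t^δ)` at `x` were not positive, the multiples of `-δ'` would form an
admissible set. Since `ϕ(t^(kδ))` tends to zero, its coefficient at `kδ'` would vanish for some `k`,
yet this coefficient is the lowest one modulo `x`. -/
theorem leadMap_pos (ϕ : L n A →A[A] L m A) (x : PrimeSpectrum A) {δ : Fin n → ℤ}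
    (hδ : LexLT 0 δ) : LexLT 0 (leadMap ϕ x δ) := by
  by_contra h
  have hadm : Adm m (Set.range fun k : ℕ => (k : ℤ) • -leadMap ϕ x δ) :=
    adm_multiples fun h' => h (by simpa using lexLT_iff_sub.1 h')
  have ht := (ϕ.cont.tendsto 0).comp (tendsto_monomial (A := A) hδ)
  have ht' := tendsto_iff.1 ht _ hadm
  obtain ⟨k, hk⟩ := ht'.exists
  have h3 : ϕ.toFun 0 = 0 := map_zero ϕ
  have h1 : coeff m (imageUnit ϕ ((k : ℤ) • δ) : L m A) (-((k : ℤ) • -leadMap ϕ x δ)) = 0 := by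
    have := hk _ ⟨k, rfl⟩
    rwa [h3, sub_zero] at this
  have h2 : leadAt (imageUnit ϕ ((k : ℤ) • δ)) x = (k : ℤ) • leadMap ϕ x δ :=
    map_zsmul (leadMap ϕ x) (k : ℤ) δ
  refine (leadAt_eq_iff.1 h2).1 (coeff_red_eq_zero.2 ?_)
  rw [smul_neg, neg_neg] at h1
  rw [h1]
  exact x.asIdeal.zero_mem

/-- For `i < j`, the vector `e_j - C e_i` is lexicographically positive for every `C`, and `leadMap`
preserves positivity. -/
theorem imageUnit_mem_H (ϕ : L n A →A[A] L m A) :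
    (fun i => imageUnit ϕ (Pi.single i 1)) ∈ H m n A := by
  refine mem_H_iff.2 fun x => IsPosEchelon.of_lexLT
    (d := fun j => leadMap ϕ x (Pi.single j 1)) (fun j => leadMap_pos ϕ x ?_)
    fun i j hij C => ?_
  · exact ⟨j, by simp, fun k hk => by simp [hk.ne']⟩
  · rw [← map_zsmul, ← map_sub]
    refine leadMap_pos ϕ x ⟨j, by simp [hij.ne'], fun k hk => ?_⟩
    simp [hk.ne', (hij.trans hk).ne']

/-- Continuous homomorphisms correspond to collections from `H`. -/
noncomputable def homEquiv (m n : ℕ) (A : Type u) [CommRing A] :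
    (L n A →A[A] L m A) ≃ H m n A where
  toFun ϕ := ⟨fun i => imageUnit ϕ (Pi.single i 1), imageUnit_mem_H ϕ⟩
  invFun φ := eval φ.2
  left_inv ϕ := by
    -- Both sides are continuous and linear and agree on monomials.
    have h : evalLin (imageUnit_mem_H ϕ) = ϕ.toAlgHom.toLinearMap :=
      linearMap_ext_monomial (continuous_evalLin _) ϕ.cont fun l => by
        rw [evalLin_monomial, ← imageUnit_eq_prod]
        rfl
    exact ContinuousAlgHom.ext fun f => LinearMap.congr_fun h f
  right_inv φ := by
    refine Subtype.ext (funext fun i => Units.ext ?_)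
    refine (evalLin_monomial φ.2 _).trans (congrArg _ ?_)
    rw [Finset.prod_eq_single i]
    · simp
    · intro j _ hj
      simp [hj]
    · simp

end Homomorphisms

end IterLaurent

theorem mainTheorem2 {A : Type*} [CommRing A] (n m : ℕ) (hn : 1 ≤ n) (hm : 1 ≤ m) :
    ∃ e : (IterLaurent.L n A →A[A] IterLaurent.L m A) ≃ IterLaurent.H m n A,
      (∀ (ϕ : IterLaurent.L n A →A[A] IterLaurent.L m A) (i : Fin n),
        (((e ϕ).1 i : (IterLaurent.L m A)ˣ) : IterLaurent.L m A) = ϕ (IterLaurent.t A i)) ∧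
      ∀ (φ : IterLaurent.H m n A) (f : IterLaurent.L n A),
        HasSum
          (fun l : Fin n → ℤ => IterLaurent.coeff n f l •
            ((∏ i, φ.1 i ^ l i : (IterLaurent.L m A)ˣ) : IterLaurent.L m A))
          (e.symm φ f) :=
  ⟨IterLaurent.homEquiv m n A, fun _ _ => rfl, fun φ f => IterLaurent.hasSum_evalLin φ.2 f⟩
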